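/- Let $\mathbb K$ be a field of characteristic $0$ and let $(A,\mu,\alpha)$ be a multiplicative hom-associative algebra over $\mathbb K$: $A$ is a $\mathbb K$-vector space, $\mu:A\times A\to A$ is bilinear and $\alpha:A\to A$ is linear, with $\mu(\alpha(a),\mu(b,c))=\mu(\mu(a,b),\alpha(c))$ and $\alpha(\mu(a,b))=\mu(\alpha(a),\alpha(b))$ for all $a,b,c\in A$. For $n\ge 1$ let $C^n_\alpha(A,A)$ be the space of multilinear maps $f:A^{\otimes n}\to A$ with $\alpha(f(a_1,\dots,a_n))=f(\alpha(a_1),\dots,\alpha(a_n))$, and let $$(\delta_\alpha f)(a_1,\dots,a_{n+1})=\mu(\alpha^{n-1}(a_1),f(a_2,\dots,a_{n+1}))+\sum_{i=1}^n(-1)^i f(\alpha(a_1),\dots,\alpha(a_{i-1}),\mu(a_i,a_{i+1}),\alpha(a_{i+2}),\dots,\alpha(a_{n+1}))+(-1)^{n+1}\mu(f(a_1,\dots,a_n),\alpha^{n-1}(a_{n+1})).$$ Put $Z^n_\alpha=\{f\in C^n_\alpha(A,A):\delta_\alpha f=0\}$ and, for $n\ge2$, $B^n_\alpha=\delta_\alpha(C^{n-1}_\alpha(A,A))$.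 Then $B^n_\alpha\subseteq Z^n_\alpha$ for $n\ge 2$; let $H^n_\alpha(A,A)=Z^n_\alpha/B^n_\alpha$ for $n\ge 2$. For $f\in C^m_\alpha(A,A)$ and $g\in C^n_\alpha(A,A)$ put $$(f\cup_\alpha g)(a_1,\dots,a_{m+n})=\mu\big(f(\alpha^{n-1}a_1,\dots,\alpha^{n-1}a_m),\,g(\alpha^{m-1}a_{m+1},\dots,\alpha^{m-1}a_{m+n})\big),$$ $$(f\circ g)(a_1,\dots,a_{m+n-1})=\sum_{i=1}^m(-1)^{(n-1)(i-1)}f(\alpha^{n-1}a_1,\dots,\alpha^{n-1}a_{i-1},g(a_i,\dots,a_{i+n-1}),\alpha^{n-1}a_{i+n},\dots,\alpha^{n-1}a_{m+n-1}),$$ $$[f,g]_\alpha=f\circ g-(-1)^{(m-1)(n-1)}g\circ f.$$ If $f\in Z^m_\alpha$ and $g\in Z^n_\alpha$ with $m,n\ge2$, then $f\cup_\alpha g\in Z^{m+n}_\alpha$ and $[f,g]_\alpha\in Z^{m+n-1}_\alpha$, and these operations induce well-defined bilinear operations $\cup_\alpha$ and $[-,-]_\alpha$ on $\bigoplus_{n\ge2}H^n_\alpha(A,A)$.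 With them $\bigoplus_{n\ge 2}H^n_\alpha(A,A)$ (graded by $\mathbb Z$, with zero components in degrees less than $2$) is a Gerstenhaber algebra. That is, for homogeneous $a,b,c$ of degrees $|a|,|b|,|c|$: - $\cup_\alpha$ has degree $0$, is associative, and $a\cup_\alpha b=(-1)^{|a||b|}\,b\cup_\alpha a$; - $[-,-]_\alpha$ is a graded Lie bracket of degree $-1$: $[a,b]_\alpha$ has degree $|a|+|b|-1$, $[a,b]_\alpha=-(-1)^{(|a|-1)(|b|-1)}[b,a]_\alpha$, and $[a,[b,c]_\alpha]_\alpha=[[a,b]_\alpha,c]_\alpha+(-1)^{(|a|-1)(|b|-1)}[b,[a,c]_\alpha]_\alpha$; - $[a\cup_\alpha b,c]_\alpha=[a,c]_\alpha\cup_\alpha b+(-1)^{(|c|-1)|a|}\,a\cup_\alpha[b,c]_\alpha$. If $\alpha=\mathrm{id}$, every multilinear map $A^{\otimes n}\to A$ is a cochain, and $\delta_\alpha$, $\cup_\alpha$ and $[-,-]_\alpha$ are the classical Hochschild coboundary, cup product and Gerstenhaber bracket of the associative algebra $(A,\mu)$. -/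

import Mathlib

open scoped DirectSum

/-- A hom-associative algebra structure on a vector space `A`: a bilinear product `mul` and a linear
map `twist` (the map `α`) such that `α(a)(bc) = (ab)α(c)`. -/
structure HomAssociativeAlgebra (K A : Type*) [Field K] [AddCommGroup A] [Module K A] where
  mul : A →ₗ[K] A →ₗ[K] A
  twist : A →ₗ[K] A
  hom_assoc : ∀ a b c, mul (twist a) (mul b c) = mul (mul a b) (twist c)

/-- Multilinear maps `A^{⊗ n} → A`. -/
abbrev Multi (K A : Type*) [Field K] [AddCommGroup A] [Module K A] (n : ℕ) :=
  MultilinearMap K (fun _ : Fin n => A) A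

section Insertion

variable {K A : Type*} [Field K] [AddCommGroup A] [Module K A]

/-- The argument list, with indices starting at `0`,
`(α^{n-1} a₀, …, α^{n-1} a_{i-1}, g (aᵢ, …, a_{i+n-1}), α^{n-1} a_{i+n}, …, α^{n-1} a_{m+n-2})`. -/
def insertArgs (α : A →ₗ[K] A) {m n : ℕ} (g : (Fin n → A) → A) (i : Fin m)
    (a : Fin (m + n - 1) → A) : Fin m → A := fun j =>
  if h : j < i then (α ^ (n - 1)) (a ⟨j, by omega⟩)
  else if h : i < j then (α ^ (n - 1)) (a ⟨j + n - 1, by omega⟩)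
  else g (fun k => a ⟨i + k, by omega⟩)

theorem insertArgs_update (α : A →ₗ[K] A) {m n : ℕ} (g : Multi K A n) (i : Fin m)
    [DecidableEq (Fin (m + n - 1))] (a : Fin (m + n - 1) → A) (t : Fin (m + n - 1)) :
    ∃ (j : Fin m) (L : A →ₗ[K] A), ∀ x : A,
      insertArgs α g i (Function.update a t x) =
        Function.update (insertArgs α g i a) j (L x) := by
  rcases lt_or_ge t.1 i.1 with h | h
  · refine ⟨⟨t, by omega⟩, α ^ (n - 1), fun x => funext fun j => ?_⟩
    simp only [insertArgs, Function.update_apply, Fin.ext_iff, Fin.lt_def]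
    by_cases hj : j.1 = t.1
    · simp [hj, h]
    · have : ∀ k : Fin n, i.1 + k.1 ≠ t.1 := fun k => by omega
      by_cases h1 : j.1 < i.1
      · simp [hj, h1]
      · by_cases h2 : i.1 < j.1
        · have : j.1 + n - 1 ≠ t.1 := by omega
          simp [hj, h1, h2, this]
        · simp [hj, h1, h2, this]
  rcases lt_or_ge t.1 (i.1 + n) with h' | h'
  · refine ⟨i, g.toLinearMap (fun k => a ⟨i + k, by omega⟩) ⟨t - i, by omega⟩,
      fun x => funext fun j => ?_⟩
    simp only [insertArgs, Function.update_apply, Fin.ext_iff, Fin.lt_def,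
      MultilinearMap.toLinearMap_apply]
    by_cases h1 : j.1 < i.1
    · have h3 : j.1 ≠ t.1 := by omega
      have h4 : j.1 ≠ i.1 := by omega
      simp [h1, h3, h4]
    · by_cases h2 : i.1 < j.1
      · have h3 : j.1 + n - 1 ≠ t.1 := by omega
        have h4 : j.1 ≠ i.1 := by omega
        simp [h1, h2, h3, h4]
      · have h4 : j.1 = i.1 := by omega
        simp only [h4, lt_irrefl, dite_false, if_true]
        congr 1
        funext k
        have : (i.1 + k.1 = t.1) ↔ (k.1 = t.1 - i.1) := by omega
        simp [Function.update_apply, Fin.ext_iff, this]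
  · refine ⟨⟨t + 1 - n, by omega⟩, α ^ (n - 1), fun x => funext fun j => ?_⟩
    simp only [insertArgs, Function.update_apply, Fin.ext_iff, Fin.lt_def]
    have : ∀ k : Fin n, i.1 + k.1 ≠ t.1 := fun k => by omega
    by_cases h1 : j.1 < i.1
    · have h3 : j.1 ≠ t.1 := by omega
      have h4 : j.1 ≠ t.1 + 1 - n := by omega
      simp [h1, h3, h4]
    · by_cases h2 : i.1 < j.1
      · have h3 : j.1 + n - 1 = t.1 ↔ j.1 = t.1 + 1 - n := by omega
        by_cases h5 : j.1 = t.1 + 1 - n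
        · simp only [h1, h2, h3.2 h5, dite_false, dite_true, if_true]
          simp [h5]
        · simp [h1, h2, h3, h5]
      · have h4 : j.1 ≠ t.1 + 1 - n := by omega
        simp [h1, h2, h4, this]

/-- `f ∘ᵢ g`, with `0 ≤ i < m`:
`(f ∘ᵢ g)(a₀, …, a_{m+n-2}) = f (α^{n-1} a₀, …, g (aᵢ, …, a_{i+n-1}), …, α^{n-1} a_{m+n-2})`. -/
def insertAt (α : A →ₗ[K] A) {m n : ℕ} (f : Multi K A m) (g : Multi K A n) (i : Fin m) :
    Multi K A (m + n - 1) where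
  toFun a := f (insertArgs α g i a)
  map_update_add' a t x y := by
    obtain ⟨j, L, h⟩ := insertArgs_update α g i a t
    simp only [h, map_add, f.map_update_add]
  map_update_smul' a t c x := by
    obtain ⟨j, L, h⟩ := insertArgs_update α g i a t
    simp only [h, map_smul, f.map_update_smul]

/-- `f ∘ g = ∑_{i=0}^{m-1} (-1)^{(n-1) i} f ∘ᵢ g`. -/
def circ (α : A →ₗ[K] A) {m n : ℕ} (f : Multi K A m) (g : Multi K A n) :
    Multi K A (m + n - 1) :=
  ∑ i : Fin m, (-1 : K) ^ ((n - 1) * (i : ℕ)) • insertAt α f g i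

/-- `[f, g]_α = f ∘ g - (-1)^{(m-1)(n-1)} g ∘ f`. -/
def bracketCochain (α : A →ₗ[K] A) {m n : ℕ} (f : Multi K A m) (g : Multi K A n) :
    Multi K A (m + n - 1) :=
  circ α f g - (-1 : K) ^ ((m - 1) * (n - 1)) •
    (circ α g f).domDomCongr (finCongr (by rw [Nat.add_comm n m]))

/-- A bilinear map as a multilinear map in two variables. -/
def mulMulti (μ : A →ₗ[K] A →ₗ[K] A) : Multi K A 2 where
  toFun a := μ (a 0) (a 1)
  map_update_add' a t x y := by
    fin_cases t <;> simp
  map_update_smul' a t c x := by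
    fin_cases t <;> simp

end Insertion

namespace HomAssociativeAlgebra

variable {K A : Type*} [Field K] [AddCommGroup A] [Module K A] (D : HomAssociativeAlgebra K A)

/-- `(A, μ, α)` is multiplicative if `α(ab) = α(a)α(b)`. -/
def IsMultiplicative : Prop :=
  ∀ a b, D.twist (D.mul a b) = D.mul (D.twist a) (D.twist b)

theorem cupArgs_update {m n : ℕ} [DecidableEq (Fin (m + n))] (a : Fin (m + n) → A)
    (t : Fin (m + n)) :
    ∃ L : A →ₗ[K] A,
      (∃ i : Fin m,
        (∀ x, (fun i => (D.twist ^ (n - 1)) (Function.update a t x (Fin.castAdd n i))) =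
          Function.update (fun i => (D.twist ^ (n - 1)) (a (Fin.castAdd n i))) i (L x)) ∧
        (∀ x, (fun i => (D.twist ^ (m - 1)) (Function.update a t x (Fin.natAdd m i))) =
          fun i => (D.twist ^ (m - 1)) (a (Fin.natAdd m i)))) ∨
      (∃ i : Fin n,
        (∀ x, (fun i => (D.twist ^ (n - 1)) (Function.update a t x (Fin.castAdd n i))) =
          fun i => (D.twist ^ (n - 1)) (a (Fin.castAdd n i))) ∧
        (∀ x, (fun i => (D.twist ^ (m - 1)) (Function.update a t x (Fin.natAdd m i))) =
          Function.update (fun i => (D.twist ^ (m - 1)) (a (Fin.natAdd m i))) i (L x))) := by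
  rcases lt_or_ge t.1 m with h | h
  · refine ⟨D.twist ^ (n - 1), Or.inl ⟨⟨t, h⟩, fun x => funext fun j => ?_, fun x => funext fun j => ?_⟩⟩
    · by_cases hj : j.1 = t.1 <;> simp [Function.update_apply, Fin.ext_iff, hj]
    · have : m + j.1 ≠ t.1 := by omega
      simp [Fin.ext_iff, this]
  · refine ⟨D.twist ^ (m - 1), Or.inr ⟨⟨t - m, by omega⟩, fun x => funext fun j => ?_,
      fun x => funext fun j => ?_⟩⟩
    · have : j.1 ≠ t.1 := by omega
      simp [Fin.ext_iff, this]
    · have : m + j.1 = t.1 ↔ j.1 = t.1 - m := by omega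
      by_cases hj : m + j.1 = t.1 <;> simp [Function.update_apply, Fin.ext_iff, ← this, hj]

/-- The cup product
`(f ∪ g)(a₁, …, a_{m+n}) =
  μ (f (α^{n-1} a₁, …, α^{n-1} a_m), g (α^{m-1} a_{m+1}, …, α^{m-1} a_{m+n}))`. -/
def cupCochain {m n : ℕ} (f : Multi K A m) (g : Multi K A n) : Multi K A (m + n) where
  toFun a := D.mul (f fun i => (D.twist ^ (n - 1)) (a (Fin.castAdd n i)))
    (g fun i => (D.twist ^ (m - 1)) (a (Fin.natAdd m i)))
  map_update_add' a t x y := by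
    obtain ⟨L, ⟨i, h, h'⟩ | ⟨i, h, h'⟩⟩ := D.cupArgs_update (m := m) (n := n) a t
    · simp only [h, h', map_add, f.map_update_add, LinearMap.add_apply]
    · simp only [h, h', map_add, g.map_update_add]
  map_update_smul' a t c x := by
    obtain ⟨L, ⟨i, h, h'⟩ | ⟨i, h, h'⟩⟩ := D.cupArgs_update (m := m) (n := n) a t
    · simp only [h, h', map_smul, f.map_update_smul, LinearMap.smul_apply]
    · simp only [h, h', map_smul, g.map_update_smul]

/-- The value of `δ_α f` at `(a₀, …, aₙ)`. -/
def differentialFun {n : ℕ} (f : (Fin n → A) → A) (a : Fin (n + 1) → A) : A :=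
  D.mul ((D.twist ^ (n - 1)) (a 0)) (f fun j => a j.succ)
    + ∑ i : Fin n, (-1 : K) ^ ((i : ℕ) + 1) • f (fun j =>
        if j < i then D.twist (a j.castSucc)
        else if i < j then D.twist (a j.succ)
        else D.mul (a i.castSucc) (a i.succ))
    + (-1 : K) ^ (n + 1) • D.mul (f fun j => a j.castSucc) ((D.twist ^ (n - 1)) (a (Fin.last n)))

/-- The coboundary of a multilinear map is multilinear. -/
theorem exists_differential {n : ℕ} (f : Multi K A n) :
    ∃ F : Multi K A (n + 1), ⇑F = D.differentialFun f := by
  let p : Multi K A (n + 1) :=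
    LinearMap.uncurryLeft
      { toFun := fun x => (D.mul ((D.twist ^ (n - 1)) x)).compMultilinearMap f
        map_add' := fun x y => by ext; simp
        map_smul' := fun c x => by ext; simp }
  let q : Multi K A (n + 1) :=
    MultilinearMap.uncurryRight
      (((D.mul.flip ∘ₗ (D.twist ^ (n - 1))).flip).compMultilinearMap f)
  let r : Fin n → Multi K A (n + 1) := fun i => insertAt D.twist f (mulMulti D.mul) i
  refine ⟨p + ∑ i : Fin n, (-1 : K) ^ ((i : ℕ) + 1) • r i + (-1 : K) ^ (n + 1) • q, funext fun a => ?_⟩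
  simp only [add_apply, smul_apply, sum_apply,
    differentialFun]
  refine congrArg₂ _ (congrArg₂ _ ?_ (Finset.sum_congr rfl fun i _ => congrArg _ ?_)) ?_
  · rfl
  · refine congrArg f (funext fun j => ?_)
    simp only [insertArgs]
    split_ifs <;> rfl
  · rfl

/-- The coboundary operator `δ_α`, on all multilinear maps. -/
def differential (n : ℕ) : Multi K A n →ₗ[K] Multi K A (n + 1) where
  toFun f :=
    { toFun := D.differentialFun f
      map_update_add' := by
        intro _ a t x y
        obtain ⟨F, hF⟩ := D.exists_differential f
        rw [← hF]
        convert F.map_update_add a t x y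
      map_update_smul' := by
        intro _ a t c x
        obtain ⟨F, hF⟩ := D.exists_differential f
        rw [← hF]
        convert F.map_update_smul a t c x }
  map_add' f g := by
    ext a
    simp only [differentialFun, MultilinearMap.coe_mk, add_apply, map_add,
      LinearMap.add_apply, smul_add, Finset.sum_add_distrib]
    abel
  map_smul' c f := by
    ext a
    simp only [differentialFun, MultilinearMap.coe_mk, smul_apply, map_smul,
      LinearMap.smul_apply, smul_add, Finset.smul_sum, RingHom.id_apply, smul_comm c]

/-- `C^n_α(A, A)`: multilinear maps with `α (f (a₁, …, aₙ)) = f (α a₁, …, α aₙ)`. -/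
def cochains (n : ℕ) : Submodule K (Multi K A n) where
  carrier := {f | ∀ a, D.twist (f a) = f fun i => D.twist (a i)}
  add_mem' hf hg a := by simp [hf a, hg a]
  zero_mem' a := by simp
  smul_mem' c f hf a := by simp [hf a]

/-- `Z^n_α(A, A)`. -/
def cocycles (n : ℕ) : Submodule K (Multi K A n) :=
  D.cochains n ⊓ LinearMap.ker (D.differential n)

/-- `B^n_α(A, A) = δ_α (C^{n-1}_α(A, A))` for `n ≥ 2`. The cochain complex starts in degree `1`. -/
def coboundaries : (n : ℕ) → Submodule K (Multi K A n)
  | 0 => ⊥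
  | 1 => ⊥
  | n + 2 => (D.cochains (n + 1)).map (D.differential (n + 1))

/-- `H^n_α(A, A) = Z^n_α(A, A) / B^n_α(A, A)`; used for `n ≥ 2` only. -/
def Cohomology (n : ℕ) : Type _ :=
  D.cocycles n ⧸ (D.coboundaries n).submoduleOf (D.cocycles n)

instance (n : ℕ) : AddCommGroup (D.Cohomology n) :=
  inferInstanceAs (AddCommGroup (D.cocycles n ⧸ (D.coboundaries n).submoduleOf (D.cocycles n)))

instance (n : ℕ) : Module K (D.Cohomology n) :=
  inferInstanceAs (Module K (D.cocycles n ⧸ (D.coboundaries n).submoduleOf (D.cocycles n)))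

/-- The quotient map `Z^n_α(A, A) → H^n_α(A, A)`. -/
def toCohomology (n : ℕ) : D.cocycles n →ₗ[K] D.Cohomology n :=
  ((D.coboundaries n).submoduleOf (D.cocycles n)).mkQ

/-- `⊕_{n ≥ 2} H^n_α(A, A)`. -/
abbrev TotalCohomology : Type _ :=
  ⨁ n : {n : ℕ // 2 ≤ n}, D.Cohomology n

/-- The class in `⊕_{n ≥ 2} H^n_α(A, A)` of an `n`-cocycle `f`. -/
def classOf {n : ℕ} (hn : 2 ≤ n) (f : Multi K A n) (hf : f ∈ D.cocycles n) :
    D.TotalCohomology :=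
  DirectSum.lof K {n : ℕ // 2 ≤ n} (fun n => D.Cohomology n) ⟨n, hn⟩
    (D.toCohomology n ⟨f, hf⟩)

/-- The homogeneous part of degree `i ∈ ℤ` of `⊕_{n ≥ 2} H^n_α(A, A)`; it is zero for `i < 2`. -/
def homogeneousPart (i : ℤ) : Submodule K D.TotalCohomology where
  carrier := {x | ∀ n : {n : ℕ // 2 ≤ n}, ((n : ℕ) : ℤ) ≠ i → x n = 0}
  add_mem' hx hy n hn := by simp [hx n hn, hy n hn]
  zero_mem' n _ := by simp
  smul_mem' c x hx n hn := by simp [DirectSum.smul_apply, hx n hn]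

end HomAssociativeAlgebra

/-- A (right) Gerstenhaber algebra over `K`: a `ℤ`-graded vector space `G = ⊕ 𝒢 i` with an
associative, graded commutative product `cup` of degree `0` and a graded Lie bracket of degree `-1`
satisfying the Leibniz rule. -/
structure IsGerstenhaberAlgebra (K : Type*) {G : Type*} [Field K] [AddCommGroup G] [Module K G]
    (𝒢 : ℤ → Submodule K G) (cup bracket : G →ₗ[K] G →ₗ[K] G) : Prop where
  isInternal : DirectSum.IsInternal 𝒢
  cup_mem : ∀ i j, ∀ a ∈ 𝒢 i, ∀ b ∈ 𝒢 j, cup a b ∈ 𝒢 (i + j)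
  cup_assoc : ∀ a b c, cup (cup a b) c = cup a (cup b c)
  cup_comm : ∀ i j, ∀ a ∈ 𝒢 i, ∀ b ∈ 𝒢 j, cup a b = (-1 : K) ^ (i * j) • cup b a
  bracket_mem : ∀ i j, ∀ a ∈ 𝒢 i, ∀ b ∈ 𝒢 j, bracket a b ∈ 𝒢 (i + j - 1)
  bracket_antisymm : ∀ i j, ∀ a ∈ 𝒢 i, ∀ b ∈ 𝒢 j,
    bracket a b = -((-1 : K) ^ ((i - 1) * (j - 1)) • bracket b a)
  jacobi : ∀ i j, ∀ a ∈ 𝒢 i, ∀ b ∈ 𝒢 j, ∀ c,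
    bracket a (bracket b c) =
      bracket (bracket a b) c + (-1 : K) ^ ((i - 1) * (j - 1)) • bracket b (bracket a c)
  leibniz : ∀ i k, ∀ a ∈ 𝒢 i, ∀ b, ∀ c ∈ 𝒢 k,
    bracket (cup a b) c = cup (bracket a c) b + (-1 : K) ^ ((k - 1) * i) • cup a (bracket b c)

/-! ### The classical operations on the Hochschild cochains of an algebra -/

namespace ClassicalHochschild

variable {K A : Type*} [Field K] [AddCommGroup A] [Module K A] (mul : A →ₗ[K] A →ₗ[K] A)

/-- The Hochschild coboundary of `f`. -/
def differential {n : ℕ} (f : (Fin n → A) → A) (a : Fin (n + 1) → A) : A :=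
  mul (a 0) (f fun j => a j.succ)
    + ∑ i : Fin n, (-1 : K) ^ ((i : ℕ) + 1) •
        f (Fin.contractNth i.castSucc (fun x y => mul x y) a)
    + (-1 : K) ^ (n + 1) • mul (f fun j => a j.castSucc) (a (Fin.last n))

/-- `(f ∪ g)(a₁, …, a_{m+n}) = f (a₁, …, a_m) g (a_{m+1}, …, a_{m+n})`. -/
def cup {m n : ℕ} (f : (Fin m → A) → A) (g : (Fin n → A) → A) (a : Fin (m + n) → A) : A :=
  mul (f fun i => a (Fin.castAdd n i)) (g fun i => a (Fin.natAdd m i))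

variable (K)

/-- `∑_{i=0}^{m-1} (-1)^{(n-1) i} f (a₀, …, a_{i-1}, g (aᵢ, …, a_{i+n-1}), a_{i+n}, …)`. -/
def circ {m n : ℕ} (f : (Fin m → A) → A) (g : (Fin n → A) → A) (a : Fin (m + n - 1) → A) : A :=
  ∑ i : Fin m, (-1 : K) ^ ((n - 1) * (i : ℕ)) • f fun j =>
    if h : j < i then a ⟨j, by omega⟩
    else if h : i < j then a ⟨j + n - 1, by omega⟩
    else g (fun k => a ⟨i + k, by omega⟩)

/-- The Gerstenhaber bracket. -/
def bracket {m n : ℕ} (f : (Fin m → A) → A) (g : (Fin n → A) → A) (a : Fin (m + n - 1) → A) : A :=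
  circ K f g a - (-1 : K) ^ ((m - 1) * (n - 1)) •
    circ K g f (fun i => a (Fin.cast (by rw [Nat.add_comm n m]) i))

end ClassicalHochschild

/-!
The cochains `C^{r+1}_α(A, A)`, with the insertions `f ∘ᵢ g` in which the remaining arguments of
`f` are twisted by `α^{n-1}` (`n` being the number of arguments of `g`), form a nonsymmetric
operad: the twists in a two-fold insertion agree because every cochain commutes with `α`.
Multiplicativity says that the product `μ` is an element of this operad, and hom-associativity says
`μ ∘₀ μ = μ ∘₁ μ`, so that `μ` is a multiplication on it. Apart from the direct check that the
cup product is associative (`signedOperad_cup_assoc`), `α` plays no role from here on, and the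
theorem is the one of Gerstenhaber and Voronov on operads with multiplication.

With the signs of the operadic suspension, let `f{g}` be the sum of all insertions of `g` into `f`,
and `f{g, h}` the sum of all insertions of `g` and `h` with `g` to the left of `h`. Sorting the
insertions by their relative position gives three identities: the graded pre-Lie identity
`SignedOperad.brace1_brace1` for `(f{g}){h}`, and the expansions `SignedOperad.brace2_brace1` of
`(f{g, h}){k}` and `SignedOperad.brace1_brace2` of `(f{g}){h, k}`. The rest is formal. The bracket
is the graded commutator of the brace, so the Jacobi identity follows from the pre-Lie identity;
the coboundary is `± [μ, -]` and the cup product is `± μ{f, g}`. The coboundary is a square-zero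
derivation of both (`d_d`, `d_bracket`, `d_cup`), so both descend to cohomology. The cup product is
associative already on cochains, by hom-associativity. It is graded commutative on cohomology
because `f{g}` bounds the commutator (`cup_comm_homotopy`), and the Leibniz rule holds there
because `h{f, g}` bounds the difference of its two sides (`bracket_cup_homotopy`). The signs enter
as scalars with square `1`, and no division by integers occurs.

To avoid casts between `m + n` and `n + m` variables, cochains are handled as functions of infinite
sequences (`evalSeq`), and their degree is the number of variables minus one.
-/

/-! ### Sums over the inputs of a composition -/

/-- The inputs of `f ∘ᵢ g` lie before `g`, inside `g` or after `g`. -/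
theorem Finset.sum_range_split {M : Type*} [AddCommMonoid M] (r s i : ℕ) (hi : i ≤ r) (F : ℕ → M) :
    ∑ j ∈ Finset.range (r + s + 1), F j =
      (∑ j ∈ Finset.range (r + 1), if j < i then F j else 0) +
      ∑ k ∈ Finset.range (s + 1), F (i + k) +
      ∑ j ∈ Finset.range (r + 1), if i < j then F (j + s) else 0 := by
  obtain ⟨p, rfl⟩ := Nat.exists_eq_add_of_le hi
  have h1 : i + p + s + 1 = (i + (s + 1)) + p := by ring
  have h2 : i + p + 1 = (i + 1) + p := by ring
  rw [h1, h2, Finset.sum_range_add, Finset.sum_range_add _ i, Finset.sum_range_add _ (i + 1),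
    Finset.sum_range_add _ (i + 1), Finset.sum_range_succ _ i, Finset.sum_range_succ _ i]
  have e1 : ∀ k ∈ Finset.range i, (if k < i then F k else 0) = F k := fun k hk => by
    rw [if_pos (Finset.mem_range.1 hk)]
  have e2 : ∀ k ∈ Finset.range i, (if i < k then F (k + s) else 0) = 0 := fun k hk => by
    rw [if_neg (by have := Finset.mem_range.1 hk; omega)]
  have e3 : ∀ k, (if i + 1 + k < i then F (i + 1 + k) else 0) = 0 := fun k => by
    rw [if_neg (by omega)]
  have e4 : ∀ k, (if i < i + 1 + k then F (i + 1 + k + s) else 0) = F (i + (s + 1) + k) :=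
    fun k => by
      rw [if_pos (by omega)]; congr 1; omega
  rw [Finset.sum_congr rfl e1, Finset.sum_congr rfl e2]
  simp only [e3, e4]
  simp

/-- The positions of an ordered pair of inputs of `f ∘ᵢ g` relative to `g`. -/
theorem Finset.sum_range_split_lt {M : Type*} [AddCommMonoid M] (r s i : ℕ) (hi : i ≤ r)
    (F : ℕ → ℕ → M) :
    (∑ j ∈ Finset.range (r + s + 1), ∑ l ∈ Finset.range (r + s + 1),
        if j < l then F j l else 0) =
      (∑ k ∈ Finset.range (s + 1), ∑ k' ∈ Finset.range (s + 1),
        if k < k' then F (i + k) (i + k') else 0) +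
      (∑ l ∈ Finset.range (r + 1), ∑ k ∈ Finset.range (s + 1),
        if i < l then F (i + k) (l + s) else 0) +
      (∑ j ∈ Finset.range (r + 1), ∑ k ∈ Finset.range (s + 1),
        if j < i then F j (i + k) else 0) +
      (∑ j ∈ Finset.range (r + 1), ∑ l ∈ Finset.range (r + 1),
        if i < j ∧ j < l then F (j + s) (l + s) else 0) +
      (∑ j ∈ Finset.range (r + 1), ∑ l ∈ Finset.range (r + 1),
        if j < i ∧ i < l then F j (l + s) else 0) +
      (∑ j ∈ Finset.range (r + 1), ∑ l ∈ Finset.range (r + 1),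
        if j < l ∧ l < i then F j l else 0) := by
  have h1 : ∀ j, j < i → (∑ l ∈ Finset.range (r + s + 1), if j < l then F j l else 0) =
      (∑ l ∈ Finset.range (r + 1), if j < l ∧ l < i then F j l else 0) +
      (∑ k ∈ Finset.range (s + 1), F j (i + k)) +
      (∑ l ∈ Finset.range (r + 1), if j < i ∧ i < l then F j (l + s) else 0) := by
    intro j hj
    rw [Finset.sum_range_split r s i hi]
    refine congrArg₂ _ (congrArg₂ _ ?_ ?_) ?_ <;> refine Finset.sum_congr rfl fun l _ => ?_
    all_goals grind
  have h2 : ∀ k ∈ Finset.range (s + 1),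
      (∑ l ∈ Finset.range (r + s + 1), if i + k < l then F (i + k) l else 0) =
      (∑ k' ∈ Finset.range (s + 1), if k < k' then F (i + k) (i + k') else 0) +
      (∑ l ∈ Finset.range (r + 1), if i < l then F (i + k) (l + s) else 0) := by
    intro k hk
    rw [Finset.mem_range] at hk
    rw [Finset.sum_range_split r s i hi, Finset.sum_eq_zero, zero_add]
    · refine congrArg₂ _ ?_ ?_ <;> refine Finset.sum_congr rfl fun l _ => ?_
      all_goals grind
    · grind
  have h3 : ∀ j, i < j → (∑ l ∈ Finset.range (r + s + 1), if j + s < l then F (j + s) l else 0) =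
      (∑ l ∈ Finset.range (r + 1), if i < j ∧ j < l then F (j + s) (l + s) else 0) := by
    intro j hj
    rw [Finset.sum_range_split r s i hi, Finset.sum_eq_zero, zero_add, Finset.sum_eq_zero, zero_add]
    · refine Finset.sum_congr rfl fun l _ => ?_
      grind
    · grind
    · grind
  rw [Finset.sum_range_split r s i hi, Finset.sum_congr rfl h2]
  have h1' : ∀ j ∈ Finset.range (r + 1),
      (if j < i then (∑ l ∈ Finset.range (r + s + 1), if j < l then F j l else 0) else 0) =
      (∑ l ∈ Finset.range (r + 1), if j < l ∧ l < i then F j l else 0) +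
      (∑ k ∈ Finset.range (s + 1), if j < i then F j (i + k) else 0) +
      (∑ l ∈ Finset.range (r + 1), if j < i ∧ i < l then F j (l + s) else 0) := by
    intro j _
    split_ifs with hj
    · exact h1 j hj
    · have : ∀ l, ¬ (j < l ∧ l < i) := by omega
      simp [hj, this]
  have h3' : ∀ j ∈ Finset.range (r + 1),
      (if i < j then (∑ l ∈ Finset.range (r + s + 1), if j + s < l then F (j + s) l else 0)
        else 0) =
      (∑ l ∈ Finset.range (r + 1), if i < j ∧ j < l then F (j + s) (l + s) else 0) := by
    intro j _
    split_ifs with hj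
    · exact h3 j hj
    · simp [hj]
  rw [Finset.sum_congr rfl h1', Finset.sum_congr rfl h3']
  simp only [Finset.sum_add_distrib]
  rw [Finset.sum_comm (s := Finset.range (s + 1)) (t := Finset.range (r + 1))]
  abel

/-- The inputs of `(f ∘ᵢ g) ∘_{j+s} h`, with `i < j`, relative to `g` and `h`. -/
theorem Finset.sum_range_split_two {M : Type*} [AddCommMonoid M] (r s t i j : ℕ) (hij : i < j)
    (hj : j ≤ r) (F : ℕ → M) :
    ∑ l ∈ Finset.range (r + s + t + 1), F l =
      (∑ l ∈ Finset.range (r + 1), if l < i then F l else 0) +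
      ∑ k ∈ Finset.range (s + 1), F (i + k) +
      (∑ l ∈ Finset.range (r + 1), if i < l ∧ l < j then F (l + s) else 0) +
      ∑ k ∈ Finset.range (t + 1), F (j + s + k) +
      ∑ l ∈ Finset.range (r + 1), if j < l then F (l + s + t) else 0 := by
  rw [Finset.sum_range_split (r + s) t (j + s) (by omega),
    Finset.sum_range_split r s i (by omega), Finset.sum_range_split r s i (by omega)]
  have e1 : ∀ k ∈ Finset.range (s + 1), (if i + k < j + s then F (i + k) else 0) = F (i + k) := by
    grind
  have e2 : ∀ k ∈ Finset.range (s + 1), (if j + s < i + k then F (i + k + t) else 0) = 0 := by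
    grind
  have e3 : ∀ k ∈ Finset.range (r + 1),
      (if k < i then if j + s < k then F (k + t) else 0 else 0) = 0 := by
    grind
  have e4 : ∀ k ∈ Finset.range (r + 1),
      (if i < k then if j + s < k + s then F (k + s + t) else 0 else 0) =
        if j < k then F (k + s + t) else 0 := by
    grind
  have e5 : ∀ k ∈ Finset.range (r + 1),
      (if k < i then if k < j + s then F k else 0 else 0) = if k < i then F k else 0 := by
    grind
  have e6 : ∀ k ∈ Finset.range (r + 1),
      (if i < k then if k + s < j + s then F (k + s) else 0 else 0) =
        if i < k ∧ k < j then F (k + s) else 0 := by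
    grind
  rw [Finset.sum_congr rfl e1, Finset.sum_congr rfl e2, Finset.sum_congr rfl e3,
    Finset.sum_congr rfl e4, Finset.sum_congr rfl e5, Finset.sum_congr rfl e6]
  simp

/-! ### Braces and their compositions -/

/-- A graded family `part r ⊆ V` (`part r` being the operations with `r + 1` inputs) with partial
compositions, in the sign convention of the operadic suspension: `comp s i f g` is `(-1)^{s i} f ∘ᵢ
g`, where `s` is the degree of `g` (its number of inputs minus one) and `i ≥ 0` is the input of `f`
into which `g` is inserted. In this convention nested compositions associate without sign, and a
sign appears only when two operations in different inputs of `f` change order.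

All operations live in the one vector space `V`, so that `part (r + s)` and `part (s + r)` can be
compared without casts; the price is that degrees are explicit arguments and that `comp` is linear
on the right only for `f ∈ part r` and `i ≤ r`. -/
structure SignedOperad (K V : Type*) [Field K] [AddCommGroup V] [Module K V] where
  part : ℕ → Submodule K V
  comp : ℕ → ℕ → V → V → V
  comp_left : ∀ s i g, IsLinearMap K fun f => comp s i f g
  comp_right : ∀ r s i f, f ∈ part r → i ≤ r → IsLinearMap K (comp s i f)
  comp_mem : ∀ r s i f g, f ∈ part r → g ∈ part s → i ≤ r → comp s i f g ∈ part (r + s)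
  comp_seq : ∀ {r s t i k f g h}, f ∈ part r → i ≤ r → k ≤ s →
    comp t (i + k) (comp s i f g) h = comp (s + t) i f (comp t k g h)
  comp_par : ∀ s t i j f g h, g ∈ part s → h ∈ part t → i < j →
    comp t (j + s) (comp s i f g) h = (-1 : K) ^ (s * t) • comp s i (comp t j f h) g

namespace SignedOperad

variable {K V : Type*} [Field K] [AddCommGroup V] [Module K V] (P : SignedOperad K V)

/-- The brace `f{g}`: the signed sum of all insertions of `g` into `f`. Here `r`, `s` are the
degrees of `f`, `g`. -/
def brace1 (r s : ℕ) (f g : V) : V := ∑ i ∈ Finset.range (r + 1), P.comp s i f g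

/-- The brace `f{g, h}`: the signed sum of all insertions of `g` and `h` into distinct inputs of
`f`, with `g` to the left of `h`. Once `g` is inserted, the inputs of `f` to its right move by the
degree `s` of `g`. -/
def brace2 (r s t : ℕ) (f g h : V) : V :=
  ∑ i ∈ Finset.range (r + 1), ∑ j ∈ Finset.range (r + 1),
    if i < j then P.comp t (j + s) (P.comp s i f g) h else 0

/-- The brace `f{g, h, k}`: the signed sum of all insertions of `g`, `h`, `k`, in this order, into
distinct inputs of `f`. -/
def brace3 (r s t u : ℕ) (f g h k : V) : V :=
  ∑ i ∈ Finset.range (r + 1), ∑ j ∈ Finset.range (r + 1), ∑ l ∈ Finset.range (r + 1),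
    if i < j ∧ j < l then P.comp u (l + s + t) (P.comp t (j + s) (P.comp s i f g) h) k else 0

theorem comp_sum_left {ι : Type*} (s i : ℕ) (S : Finset ι) (F : ι → V) (g : V) :
    P.comp s i (∑ x ∈ S, F x) g = ∑ x ∈ S, P.comp s i (F x) g :=
  map_sum (P.comp_left s i g).mk' F S

theorem comp_zero_left (s i : ℕ) (g : V) : P.comp s i 0 g = 0 :=
  map_zero (P.comp_left s i g).mk'

theorem comp_smul_left (s i : ℕ) (c : K) (f g : V) :
    P.comp s i (c • f) g = c • P.comp s i f g :=
  (P.comp_left s i g).map_smul c f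

theorem comp_sum_right {ι : Type*} {r s i : ℕ} {f : V} (hf : f ∈ P.part r) (hi : i ≤ r)
    (S : Finset ι) (F : ι → V) :
    P.comp s i f (∑ x ∈ S, F x) = ∑ x ∈ S, P.comp s i f (F x) :=
  map_sum (P.comp_right r s i f hf hi).mk' F S

theorem comp_zero_right {r s i : ℕ} {f : V} (hf : f ∈ P.part r) (hi : i ≤ r) :
    P.comp s i f 0 = 0 :=
  map_zero (P.comp_right r s i f hf hi).mk'

theorem comp_ite_right (p : Prop) [Decidable p] {r s i : ℕ} {f : V} (hf : f ∈ P.part r)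
    (hi : i ≤ r) (g : V) :
    P.comp s i f (if p then g else 0) = if p then P.comp s i f g else 0 := by
  split_ifs
  · rfl
  · exact P.comp_zero_right hf hi

/-- The parallel axiom, read from right to left. -/
theorem comp_comp_of_lt {s t i j : ℕ} {g h : V} (f : V) (hg : g ∈ P.part s)
    (hh : h ∈ P.part t) (hij : j < i) :
    P.comp t j (P.comp s i f g) h =
      (-1 : K) ^ (s * t) • P.comp s (i + t) (P.comp t j f h) g := by
  rw [P.comp_par t s j i f h g hh hg hij, smul_smul, mul_comm t s, ← mul_pow]
  simp

/-- The graded pre-Lie identity. In `(f{g}){h}` the operation `h` enters `g`, or an input of `f` to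
the right or to the left of `g`; so the associator of the brace is symmetric up to sign in `g, h`.
-/
theorem brace1_brace1 {r s t : ℕ} {f g h : V} (hf : f ∈ P.part r) (hg : g ∈ P.part s)
    (hh : h ∈ P.part t) :
    P.brace1 (r + s) t (P.brace1 r s f g) h =
      P.brace1 r (s + t) f (P.brace1 s t g h) + P.brace2 r s t f g h +
        (-1 : K) ^ (s * t) • P.brace2 r t s f h g := by
  have key : ∀ i ∈ Finset.range (r + 1), ∑ j ∈ Finset.range (r + s + 1),
      P.comp t j (P.comp s i f g) h = P.comp (s + t) i f (P.brace1 s t g h) +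
        (∑ j ∈ Finset.range (r + 1),
          if i < j then P.comp t (j + s) (P.comp s i f g) h else 0) +
        (-1 : K) ^ (s * t) • ∑ j ∈ Finset.range (r + 1),
          if j < i then P.comp s (i + t) (P.comp t j f h) g else 0 := by
    intro i hi
    have hi' : i ≤ r := by have := Finset.mem_range.1 hi; omega
    rw [Finset.sum_range_split r s i hi', brace1, P.comp_sum_right hf hi']
    rw [Finset.sum_congr rfl fun k hk => P.comp_seq hf hi'
      (by have := Finset.mem_range.1 hk; omega)]
    rw [Finset.smul_sum, add_comm (Finset.sum _ _) (Finset.sum _ _), add_right_comm]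
    congr 1
    refine Finset.sum_congr rfl fun j _ => ?_
    split_ifs with hj
    · exact P.comp_comp_of_lt f hg hh hj
    · simp
  rw [brace1, brace1]
  simp only [comp_sum_left]
  rw [Finset.sum_comm, Finset.sum_congr rfl key]
  simp only [Finset.sum_add_distrib]
  rw [← Finset.smul_sum, brace2, brace2,
    Finset.sum_comm (f := fun j i => if j < i then P.comp s (i + t) (P.comp t j f h) g else 0)]
  rfl

/-- In `(f{g, h}){k}` the operation `k` enters `h`, or `g`, or one of the inputs of `f` that are
left; it then has three possible positions relative to `g` and `h`. -/
theorem brace2_brace1 {r s t u : ℕ} {f g h k : V} (hf : f ∈ P.part r) (hg : g ∈ P.part s)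
    (hh : h ∈ P.part t) (hk : k ∈ P.part u) :
    P.brace1 (r + s + t) u (P.brace2 r s t f g h) k =
      P.brace2 r s (t + u) f g (P.brace1 t u h k) +
      (-1 : K) ^ (t * u) • P.brace2 r (s + u) t f (P.brace1 s u g k) h +
      P.brace3 r s t u f g h k +
      (-1 : K) ^ (t * u) • P.brace3 r s u t f g k h +
      (-1 : K) ^ (t * u + s * u) • P.brace3 r u s t f k g h := by
  have key : ∀ i ∈ Finset.range (r + 1), ∀ j ∈ Finset.range (r + 1),
      (∑ l ∈ Finset.range (r + s + t + 1),
        P.comp u l (if i < j then P.comp t (j + s) (P.comp s i f g) h else 0) k) =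
      (if i < j then P.comp (t + u) (j + s) (P.comp s i f g) (P.brace1 t u h k) else 0) +
      (-1 : K) ^ (t * u) •
        (if i < j then P.comp t (j + (s + u)) (P.comp (s + u) i f (P.brace1 s u g k)) h else 0) +
      (∑ l ∈ Finset.range (r + 1), if i < j ∧ j < l then
        P.comp u (l + s + t) (P.comp t (j + s) (P.comp s i f g) h) k else 0) +
      (-1 : K) ^ (t * u) • (∑ l ∈ Finset.range (r + 1), if i < l ∧ l < j then
        P.comp t (j + s + u) (P.comp u (l + s) (P.comp s i f g) k) h else 0) +
      (-1 : K) ^ (t * u + s * u) • (∑ l ∈ Finset.range (r + 1), if l < i ∧ i < j then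
        P.comp t (j + u + s) (P.comp s (i + u) (P.comp u l f k) g) h else 0) := by
    intro i hi j hj
    rw [Finset.mem_range] at hi hj
    by_cases hij : i < j
    swap
    · have h2 : ∀ l, ¬ (i < l ∧ l < j) := by omega
      simp [hij, h2, comp_zero_left]
    simp only [hij, if_true, true_and, and_true]
    rw [Finset.sum_range_split_two r s t i j hij (by omega), brace1, brace1,
      P.comp_sum_right (P.comp_mem r s i f g hf hg (by omega)) (by omega),
      P.comp_sum_right hf (by omega), P.comp_sum_left]
    -- `k` to the left of `g`: it moves past both `h` and `g`.
    have e1 : ∀ l ∈ Finset.range (r + 1),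
        (if l < i then P.comp u l (P.comp t (j + s) (P.comp s i f g) h) k else 0) =
        (-1 : K) ^ (t * u + s * u) •
          if l < i then P.comp t (j + u + s) (P.comp s (i + u) (P.comp u l f k) g) h else 0 := by
      intro l _
      split_ifs with hl
      · rw [P.comp_comp_of_lt _ hh hk (by omega), P.comp_comp_of_lt _ hg hk hl, comp_smul_left,
          smul_smul, ← pow_add, add_right_comm j s u]
      · simp
    -- `k` inside `g`: it moves past `h` only.
    have e2 : ∀ l ∈ Finset.range (s + 1),
        P.comp u (i + l) (P.comp t (j + s) (P.comp s i f g) h) k =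
        (-1 : K) ^ (t * u) •
          P.comp t (j + (s + u)) (P.comp (s + u) i f (P.comp u l g k)) h := by
      intro l hl
      rw [Finset.mem_range] at hl
      rw [P.comp_comp_of_lt _ hh hk (by omega), P.comp_seq hf (by omega) (by omega), add_assoc]
    -- `k` between `g` and `h`.
    have e3 : ∀ l ∈ Finset.range (r + 1),
        (if i < l ∧ l < j then P.comp u (l + s) (P.comp t (j + s) (P.comp s i f g) h) k else 0) =
        (-1 : K) ^ (t * u) • if i < l ∧ l < j then
          P.comp t (j + s + u) (P.comp u (l + s) (P.comp s i f g) k) h else 0 := by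
      intro l _
      split_ifs with hl
      · rw [P.comp_comp_of_lt _ hh hk (by omega)]
      · simp
    -- `k` inside `h`.
    have e4 : ∀ l ∈ Finset.range (t + 1),
        P.comp u (j + s + l) (P.comp t (j + s) (P.comp s i f g) h) k =
          P.comp (t + u) (j + s) (P.comp s i f g) (P.comp u l h k) := by
      intro l hl
      rw [Finset.mem_range] at hl
      rw [P.comp_seq (P.comp_mem r s i f g hf hg (by omega)) (by omega) (by omega)]
    rw [Finset.sum_congr rfl e1, Finset.sum_congr rfl e2, Finset.sum_congr rfl e3,
      Finset.sum_congr rfl e4]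
    simp only [← Finset.smul_sum]
    abel
  have lhs : P.brace1 (r + s + t) u (P.brace2 r s t f g h) k =
      ∑ i ∈ Finset.range (r + 1), ∑ j ∈ Finset.range (r + 1), ∑ l ∈ Finset.range (r + s + t + 1),
        P.comp u l (if i < j then P.comp t (j + s) (P.comp s i f g) h else 0) k := by
    simp only [brace1, brace2, comp_sum_left]
    rw [Finset.sum_comm]
    exact Finset.sum_congr rfl fun i _ => Finset.sum_comm
  rw [lhs, Finset.sum_congr rfl fun i hi => Finset.sum_congr rfl fun j hj => key i hi j hj]
  simp only [Finset.sum_add_distrib, ← Finset.smul_sum]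
  simp only [brace2, brace3]
  congr 1
  · congr 2
    exact Finset.sum_congr rfl fun i _ => Finset.sum_comm
  · congr 1
    rw [Finset.sum_congr rfl fun i _ => Finset.sum_comm, Finset.sum_comm]

/-- In `(f{g}){h, k}` the operations `h` and `k` both enter `g`, or just one of them
does, or neither. -/
theorem brace1_brace2 {r s t u : ℕ} {f g h k : V} (hf : f ∈ P.part r) (hg : g ∈ P.part s)
    (hh : h ∈ P.part t) (hk : k ∈ P.part u) :
    P.brace2 (r + s) t u (P.brace1 r s f g) h k =
      P.brace1 r (s + t + u) f (P.brace2 s t u g h k) +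
      P.brace2 r (s + t) u f (P.brace1 s t g h) k +
      (-1 : K) ^ (s * t) • P.brace2 r t (s + u) f h (P.brace1 s u g k) +
      P.brace3 r s t u f g h k +
      (-1 : K) ^ (s * t) • P.brace3 r t s u f h g k +
      (-1 : K) ^ (s * t + s * u) • P.brace3 r t u s f h k g := by
  have key : ∀ i ∈ Finset.range (r + 1),
      (∑ j ∈ Finset.range (r + s + 1), ∑ l ∈ Finset.range (r + s + 1), if j < l then
        P.comp u (l + t) (P.comp t j (P.comp s i f g) h) k else 0) =
      P.comp (s + t + u) i f (P.brace2 s t u g h k) +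
      (∑ l ∈ Finset.range (r + 1), if i < l then
        P.comp u (l + (s + t)) (P.comp (s + t) i f (P.brace1 s t g h)) k else 0) +
      (-1 : K) ^ (s * t) • (∑ j ∈ Finset.range (r + 1), if j < i then
        P.comp (s + u) (i + t) (P.comp t j f h) (P.brace1 s u g k) else 0) +
      (∑ j ∈ Finset.range (r + 1), ∑ l ∈ Finset.range (r + 1), if i < j ∧ j < l then
        P.comp u (l + s + t) (P.comp t (j + s) (P.comp s i f g) h) k else 0) +
      (-1 : K) ^ (s * t) • (∑ j ∈ Finset.range (r + 1), ∑ l ∈ Finset.range (r + 1),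
        if j < i ∧ i < l then
          P.comp u (l + t + s) (P.comp s (i + t) (P.comp t j f h) g) k else 0) +
      (-1 : K) ^ (s * t + s * u) • (∑ j ∈ Finset.range (r + 1), ∑ l ∈ Finset.range (r + 1),
        if j < l ∧ l < i then
          P.comp s (i + t + u) (P.comp u (l + t) (P.comp t j f h) k) g else 0) := by
    intro i hi
    rw [Finset.mem_range] at hi
    rw [Finset.sum_range_split_lt r s i (by omega)]
    simp only [Finset.smul_sum]
    refine congrArg₂ _ (congrArg₂ _ (congrArg₂ _ (congrArg₂ _ (congrArg₂ _ ?_ ?_) ?_) ?_) ?_) ?_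
    -- In this order: both inside `g`; `h` inside and `k` after; `h` before and `k` inside;
    -- both after; `h` before and `k` after; both before.
    · rw [brace2, P.comp_sum_right hf (by omega)]
      refine Finset.sum_congr rfl fun j hj => ?_
      rw [P.comp_sum_right hf (by omega)]
      refine Finset.sum_congr rfl fun l hl => ?_
      rw [Finset.mem_range] at hj hl
      rw [P.comp_ite_right _ hf (by omega), P.comp_seq hf (by omega) (by omega), add_assoc i l t,
        P.comp_seq hf (by omega) (by omega)]
    · refine Finset.sum_congr rfl fun l _ => ?_
      split_ifs with hl
      · rw [brace1, P.comp_sum_right hf (by omega), P.comp_sum_left]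
        refine Finset.sum_congr rfl fun j hj => ?_
        rw [Finset.mem_range] at hj
        rw [P.comp_seq hf (by omega) (by omega), add_assoc]
      · simp
    · refine Finset.sum_congr rfl fun j hj => ?_
      rw [Finset.mem_range] at hj
      split_ifs with hji
      · rw [brace1, P.comp_sum_right (P.comp_mem r t j f h hf hh (by omega)) (by omega),
          Finset.smul_sum]
        refine Finset.sum_congr rfl fun l hl => ?_
        rw [Finset.mem_range] at hl
        rw [P.comp_comp_of_lt _ hg hh hji, comp_smul_left, add_right_comm i l t,
          P.comp_seq (P.comp_mem r t j f h hf hh (by omega)) (by omega) (by omega)]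
      · simp
    · rfl
    · refine Finset.sum_congr rfl fun j hj => Finset.sum_congr rfl fun l hl => ?_
      split_ifs with hji
      · rw [P.comp_comp_of_lt _ hg hh hji.1, comp_smul_left, add_right_comm l s t]
      · simp
    · refine Finset.sum_congr rfl fun j hj => Finset.sum_congr rfl fun l hl => ?_
      split_ifs with hji
      · rw [P.comp_comp_of_lt _ hg hh (by omega), comp_smul_left,
          P.comp_comp_of_lt _ hg hk (by omega), smul_smul, ← pow_add]
      · simp
  have lhs : P.brace2 (r + s) t u (P.brace1 r s f g) h k =
      ∑ i ∈ Finset.range (r + 1),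
      (∑ j ∈ Finset.range (r + s + 1), ∑ l ∈ Finset.range (r + s + 1), if j < l then
        P.comp u (l + t) (P.comp t j (P.comp s i f g) h) k else 0) := by
    rw [brace2, eq_comm, Finset.sum_comm]
    refine Finset.sum_congr rfl fun j _ => ?_
    rw [Finset.sum_comm]
    refine Finset.sum_congr rfl fun l _ => ?_
    split_ifs
    · simp only [brace1, comp_sum_left]
    · simp
  rw [lhs, Finset.sum_congr rfl key]
  simp only [Finset.sum_add_distrib, ← Finset.smul_sum]
  simp only [brace2, brace3]
  refine congrArg₂ _ (congrArg₂ _ (congrArg₂ _ (congrArg₂ _ (congrArg₂ _ ?_ ?_) ?_) ?_) ?_) ?_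
  · rfl
  · rfl
  · rw [Finset.sum_comm]
  · rfl
  · rw [Finset.sum_comm]
  · rw [Finset.sum_comm, Finset.sum_congr rfl fun i _ => Finset.sum_comm]

end SignedOperad

/-! ### Linearity and degrees of braces, the graded Lie bracket -/

namespace SignedOperad

variable {K V : Type*} [Field K] [AddCommGroup V] [Module K V] (P : SignedOperad K V)

theorem isLinearMap_brace1_left (r s : ℕ) (g : V) : IsLinearMap K fun f => P.brace1 r s f g where
  map_add f f' := by
    simp only [brace1, (P.comp_left s _ g).map_add, Finset.sum_add_distrib]
  map_smul c f := by
    simp only [brace1, comp_smul_left, Finset.smul_sum]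

theorem isLinearMap_brace1_right {r : ℕ} (s : ℕ) {f : V} (hf : f ∈ P.part r) :
    IsLinearMap K fun g => P.brace1 r s f g := by
  have h : ∀ i ∈ Finset.range (r + 1), IsLinearMap K (P.comp s i f) := fun i hi =>
    P.comp_right r s i f hf (by rw [Finset.mem_range] at hi; omega)
  constructor
  · intro g g'
    simp only [brace1]
    rw [← Finset.sum_add_distrib]
    exact Finset.sum_congr rfl fun i hi => (h i hi).map_add g g'
  · intro c g
    simp only [brace1]
    rw [Finset.smul_sum]
    exact Finset.sum_congr rfl fun i hi => (h i hi).map_smul c g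

theorem isLinearMap_brace2_middle {r : ℕ} (s t : ℕ) {f : V} (hf : f ∈ P.part r) (h : V) :
    IsLinearMap K fun g => P.brace2 r s t f g h := by
  have h' : ∀ i ∈ Finset.range (r + 1), IsLinearMap K (P.comp s i f) := fun i hi =>
    P.comp_right r s i f hf (by rw [Finset.mem_range] at hi; omega)
  constructor
  · intro g g'
    simp only [brace2]
    rw [← Finset.sum_add_distrib]
    refine Finset.sum_congr rfl fun i hi => ?_
    rw [← Finset.sum_add_distrib]
    refine Finset.sum_congr rfl fun j _ => ?_
    rw [(h' i hi).map_add, (P.comp_left t _ h).map_add]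
    split_ifs <;> simp
  · intro c g
    simp only [brace2, Finset.smul_sum]
    refine Finset.sum_congr rfl fun i hi => Finset.sum_congr rfl fun j _ => ?_
    rw [(h' i hi).map_smul, comp_smul_left, smul_ite, smul_zero]

theorem isLinearMap_brace2_right {r s : ℕ} (t : ℕ) {f g : V} (hf : f ∈ P.part r)
    (hg : g ∈ P.part s) : IsLinearMap K fun h => P.brace2 r s t f g h := by
  have h' : ∀ i ∈ Finset.range (r + 1), ∀ j ∈ Finset.range (r + 1),
      IsLinearMap K (P.comp t (j + s) (P.comp s i f g)) := fun i hi j hj => by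
    rw [Finset.mem_range] at hi hj
    exact P.comp_right (r + s) t (j + s) _ (P.comp_mem r s i f g hf hg (by omega)) (by omega)
  constructor
  · intro h k
    simp only [brace2]
    rw [← Finset.sum_add_distrib]
    refine Finset.sum_congr rfl fun i hi => ?_
    rw [← Finset.sum_add_distrib]
    refine Finset.sum_congr rfl fun j hj => ?_
    rw [(h' i hi j hj).map_add]
    split_ifs <;> simp
  · intro c h
    simp only [brace2, Finset.smul_sum]
    refine Finset.sum_congr rfl fun i hi => Finset.sum_congr rfl fun j hj => ?_
    rw [(h' i hi j hj).map_smul, smul_ite, smul_zero]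

theorem isLinearMap_brace2_left (r s t : ℕ) (g h : V) :
    IsLinearMap K fun f => P.brace2 r s t f g h where
  map_add f f' := by
    simp only [brace2, (P.comp_left s _ g).map_add, (P.comp_left t _ h).map_add]
    simp only [← Finset.sum_add_distrib]
    refine Finset.sum_congr rfl fun i _ => Finset.sum_congr rfl fun j _ => ?_
    split_ifs <;> simp
  map_smul c f := by
    simp only [brace2, comp_smul_left, Finset.smul_sum, smul_ite, smul_zero]

theorem brace1_mem {r s : ℕ} {f g : V} (hf : f ∈ P.part r) (hg : g ∈ P.part s) :
    P.brace1 r s f g ∈ P.part (r + s) :=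
  Submodule.sum_mem _ fun i hi =>
    P.comp_mem r s i f g hf hg (by rw [Finset.mem_range] at hi; omega)

theorem brace2_mem {r s t : ℕ} {f g h : V} (hf : f ∈ P.part r) (hg : g ∈ P.part s)
    (hh : h ∈ P.part t) : P.brace2 r s t f g h ∈ P.part (r + s + t) := by
  refine Submodule.sum_mem _ fun i hi => Submodule.sum_mem _ fun j hj => ?_
  rw [Finset.mem_range] at hi hj
  split_ifs
  · exact P.comp_mem _ _ _ _ _ (P.comp_mem r s i f g hf hg (by omega)) hh (by omega)
  · exact Submodule.zero_mem _

/-- A binary operation has no room for three insertions. -/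
theorem brace3_one (s t u : ℕ) (f g h k : V) : P.brace3 1 s t u f g h k = 0 := by
  refine Finset.sum_eq_zero fun i _ => Finset.sum_eq_zero fun j _ =>
    Finset.sum_eq_zero fun l hl => ?_
  rw [Finset.mem_range] at hl
  rw [if_neg (by omega)]

/-- The Gerstenhaber bracket `[f, g] = f{g} - (-1)^{rs} g{f}`. -/
def bracket (r s : ℕ) (f g : V) : V :=
  P.brace1 r s f g - (-1 : K) ^ (r * s) • P.brace1 s r g f

theorem bracket_mem {r s : ℕ} {f g : V} (hf : f ∈ P.part r) (hg : g ∈ P.part s) :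
    P.bracket r s f g ∈ P.part (r + s) :=
  Submodule.sub_mem _ (P.brace1_mem hf hg)
    (Submodule.smul_mem _ _ (by rw [add_comm]; exact P.brace1_mem hg hf))

theorem neg_one_pow_mul_self (n : ℕ) : (-1 : K) ^ n * (-1 : K) ^ n = 1 := by
  rw [← mul_pow]; simp

theorem bracket_antisymm (r s : ℕ) (f g : V) :
    P.bracket r s f g = -((-1 : K) ^ (r * s) • P.bracket s r g f) := by
  have h := neg_one_pow_mul_self (K := K) (r * s)
  rw [bracket, bracket, mul_comm s r]
  linear_combination (norm := skip)
  match_scalars <;> grind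

/-- The graded Jacobi identity, a formal consequence of the graded pre-Lie identity. -/
theorem bracket_bracket {r s t : ℕ} {f g h : V} (hf : f ∈ P.part r) (hg : g ∈ P.part s)
    (hh : h ∈ P.part t) :
    P.bracket r (s + t) f (P.bracket s t g h) =
      P.bracket (r + s) t (P.bracket r s f g) h +
        (-1 : K) ^ (r * s) • P.bracket s (r + t) g (P.bracket r t f h) := by
  have a1 := P.brace1_brace1 hf hg hh
  have a2 := P.brace1_brace1 hg hf hh
  have a3 := P.brace1_brace1 hg hh hf
  have a4 := P.brace1_brace1 hh hg hf
  have a5 := P.brace1_brace1 hf hh hg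
  have a6 := P.brace1_brace1 hh hf hg
  have e1 := neg_one_pow_mul_self (K := K) (r * s)
  have e2 := neg_one_pow_mul_self (K := K) (r * t)
  have e3 := neg_one_pow_mul_self (K := K) (s * t)
  simp only [bracket, (P.isLinearMap_brace1_right _ hf).map_sub,
    (P.isLinearMap_brace1_right _ hf).map_smul, (P.isLinearMap_brace1_right _ hg).map_sub,
    (P.isLinearMap_brace1_right _ hg).map_smul, (P.isLinearMap_brace1_right _ hh).map_sub,
    (P.isLinearMap_brace1_right _ hh).map_smul, (P.isLinearMap_brace1_left _ _ _).map_sub,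
    (P.isLinearMap_brace1_left _ _ _).map_smul]
  simp only [add_comm s r, add_comm t r, add_comm t s, mul_comm s r, mul_comm t r, mul_comm t s,
    mul_add, add_mul, pow_add] at a1 a2 a3 a4 a5 a6 ⊢
  -- From here on the signs are scalars with square `1`, and coefficients are compared by `grind`.
  generalize (-1 : K) ^ (r * s) = x at *
  generalize (-1 : K) ^ (r * t) = y at *
  generalize (-1 : K) ^ (s * t) = z at *
  -- Each of the six pre-Lie identities enters with the sign of its product in the expansion.
  linear_combination (norm := skip) (-1 : K) • a1 + x • a2 - (x * y) • a3 + (x * y * z) • a4 +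
    z • a5 - (y * z) • a6
  match_scalars <;> grind

end SignedOperad

/-! ### Multiplications: coboundary, cup product and homotopies -/

/-- A multiplication on a signed operad: a binary operation `μ` with `μ{μ} = 0`, which in the
unsigned convention says that `μ ∘₀ μ = μ ∘₁ μ`. -/
structure SignedOperad.IsMultiplication {K V : Type*} [Field K] [AddCommGroup V] [Module K V]
    (P : SignedOperad K V) (μ : V) : Prop where
  mem : μ ∈ P.part 1
  brace1_self : P.brace1 1 1 μ μ = 0

namespace SignedOperad

variable {K V : Type*} [Field K] [AddCommGroup V] [Module K V] (P : SignedOperad K V)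

/-- The coboundary `δ f = (-1)^r [μ, f]` defined by a multiplication `μ`. -/
def d (μ : V) (r : ℕ) (f : V) : V := (-1 : K) ^ r • P.brace1 1 r μ f - P.brace1 r 1 f μ

/-- The cup product `f ∪ g = (μ ∘₀ f) ∘_{r+1} g`. The sign turns the brace `μ{f, g}`, formed with
signed compositions, into this unsigned composition. -/
def cup (μ : V) (r s : ℕ) (f g : V) : V := (-1 : K) ^ (s * (r + 1)) • P.brace2 1 r s μ f g

variable {P} {μ : V} (hμ : P.IsMultiplication μ)
include hμ

theorem d_mem {r : ℕ} {f : V} (hf : f ∈ P.part r) : P.d μ r f ∈ P.part (r + 1) :=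
  Submodule.sub_mem _
    (Submodule.smul_mem _ _ (by rw [add_comm]; exact P.brace1_mem hμ.mem hf))
    (P.brace1_mem hf hμ.mem)

theorem cup_mem {r s : ℕ} {f g : V} (hf : f ∈ P.part r) (hg : g ∈ P.part s) :
    P.cup μ r s f g ∈ P.part (r + s + 1) :=
  Submodule.smul_mem _ _ (by
    have := P.brace2_mem hμ.mem hf hg
    rwa [show 1 + r + s = r + s + 1 by ring] at this)

theorem isLinearMap_d (r : ℕ) : IsLinearMap K (P.d μ r) := by
  constructor
  · intro f g
    simp only [d, (P.isLinearMap_brace1_right _ hμ.mem).map_add,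
      (P.isLinearMap_brace1_left _ _ _).map_add]
    module
  · intro c f
    simp only [d, (P.isLinearMap_brace1_right _ hμ.mem).map_smul,
      (P.isLinearMap_brace1_left _ _ _).map_smul]
    module

/-- From `μ{μ} = 0` and the pre-Lie identity. The identity `[μ, [μ, f]] = [[μ, μ], f] / 2` would
need `2` to be invertible. -/
theorem d_d {r : ℕ} {f : V} (hf : f ∈ P.part r) : P.d μ (r + 1) (P.d μ r f) = 0 := by
  have a1 := P.brace1_brace1 hf hμ.mem hμ.mem
  have a2 := P.brace1_brace1 hμ.mem hf hμ.mem
  have a3 := P.brace1_brace1 hμ.mem hμ.mem hf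
  have e1 := neg_one_pow_mul_self (K := K) r
  rw [hμ.brace1_self] at a1 a3
  rw [(P.isLinearMap_brace1_right _ hf).map_zero] at a1
  rw [(P.isLinearMap_brace1_left _ _ _).map_zero] at a3
  simp only [d, (P.isLinearMap_brace1_right _ hμ.mem).map_sub,
    (P.isLinearMap_brace1_right _ hμ.mem).map_smul, (P.isLinearMap_brace1_left _ _ _).map_sub,
    (P.isLinearMap_brace1_left _ _ _).map_smul]
  simp only [add_comm 1 r, pow_add, pow_one, mul_one, one_mul] at a1 a2 a3 ⊢
  generalize (-1 : K) ^ r = x at *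
  linear_combination (norm := skip) a3 + a1 - x • a2
  match_scalars <;> grind

omit hμ in
/-- The coboundary is an inner derivation of the bracket. -/
theorem d_eq_neg_bracket (r : ℕ) (f : V) : P.d μ r f = -P.bracket r 1 f μ := by
  rw [d, bracket, mul_one, neg_sub]

omit hμ in
theorem isLinearMap_bracket_left {r s : ℕ} {g : V} (hg : g ∈ P.part s) :
    IsLinearMap K fun f => P.bracket r s f g where
  map_add f f' := by
    simp only [bracket, (P.isLinearMap_brace1_right _ hg).map_add,
      (P.isLinearMap_brace1_left _ _ _).map_add]
    module
  map_smul c f := by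
    simp only [bracket, (P.isLinearMap_brace1_right _ hg).map_smul,
      (P.isLinearMap_brace1_left _ _ _).map_smul]
    module

omit hμ in
theorem isLinearMap_bracket_right {r s : ℕ} {f : V} (hf : f ∈ P.part r) :
    IsLinearMap K fun g => P.bracket r s f g where
  map_add g g' := by
    simp only [bracket, (P.isLinearMap_brace1_right _ hf).map_add,
      (P.isLinearMap_brace1_left _ _ _).map_add]
    module
  map_smul c g := by
    simp only [bracket, (P.isLinearMap_brace1_right _ hf).map_smul,
      (P.isLinearMap_brace1_left _ _ _).map_smul]
    module

theorem isLinearMap_cup_left {r s : ℕ} {g : V} :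
    IsLinearMap K fun f => P.cup μ r s f g where
  map_add f f' := by
    simp only [cup, (P.isLinearMap_brace2_middle _ _ hμ.mem _).map_add, smul_add]
  map_smul c f := by
    simp only [cup, (P.isLinearMap_brace2_middle _ _ hμ.mem _).map_smul, smul_comm c]

theorem isLinearMap_cup_right {r s : ℕ} {f : V} (hf : f ∈ P.part r) :
    IsLinearMap K fun g => P.cup μ r s f g where
  map_add g g' := by
    simp only [cup, (P.isLinearMap_brace2_right _ hμ.mem hf).map_add, smul_add]
  map_smul c g := by
    simp only [cup, (P.isLinearMap_brace2_right _ hμ.mem hf).map_smul, smul_comm c]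

/-- The coboundary is a derivation of the bracket: the Jacobi identity for `f, g, μ`. -/
theorem d_bracket {r s : ℕ} {f g : V} (hf : f ∈ P.part r) (hg : g ∈ P.part s) :
    P.d μ (r + s) (P.bracket r s f g) =
      P.bracket r (s + 1) f (P.d μ s g) + (-1 : K) ^ s • P.bracket (r + 1) s (P.d μ r f) g := by
  have h := P.bracket_bracket hf hg hμ.mem
  rw [P.bracket_antisymm s (r + 1), mul_add, mul_one, mul_comm s r] at h
  simp only [d_eq_neg_bracket, (isLinearMap_bracket_left hg).map_neg,
    (isLinearMap_bracket_right hf).map_neg]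
  rw [h, smul_neg, smul_neg, smul_smul, ← pow_add, ← add_assoc, pow_add, pow_add,
    neg_one_pow_mul_self, one_mul]
  abel

/-- The coboundary is a derivation of the cup product: since `μ` is binary, moving `μ` through
`μ{f, g}` leaves no brace with three insertions. -/
theorem d_cup {r s : ℕ} {f g : V} (hf : f ∈ P.part r) (hg : g ∈ P.part s) :
    P.d μ (r + s + 1) (P.cup μ r s f g) =
      P.cup μ (r + 1) s (P.d μ r f) g + (-1 : K) ^ (r + 1) • P.cup μ r (s + 1) f (P.d μ s g) := by
  have a1 := P.brace2_brace1 hμ.mem hf hg hμ.mem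
  have a2 := P.brace1_brace2 hμ.mem hμ.mem hf hg
  have e1 := neg_one_pow_mul_self (K := K) r
  have e2 := neg_one_pow_mul_self (K := K) s
  have e3 := neg_one_pow_mul_self (K := K) (r * s)
  rw [hμ.brace1_self, (P.isLinearMap_brace2_left _ _ _ _ _).map_zero] at a2
  simp only [cup, d, (P.isLinearMap_brace1_right _ hμ.mem).map_smul,
    (P.isLinearMap_brace1_left _ _ _).map_smul,
    (P.isLinearMap_brace2_middle _ _ hμ.mem _).map_smul,
    (P.isLinearMap_brace2_middle _ _ hμ.mem _).map_sub,
    (P.isLinearMap_brace2_right _ hμ.mem hf).map_smul,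
    (P.isLinearMap_brace2_right _ hμ.mem hf).map_sub]
  simp only [brace3_one, smul_zero, add_zero, add_comm 1 r, add_comm 1 s,
    add_right_comm r 1 s, mul_comm s r, pow_add, mul_add, add_mul, pow_one, mul_one,
    one_mul] at a1 a2 ⊢
  generalize (-1 : K) ^ (r * s) = z at *
  generalize (-1 : K) ^ r = x at *
  generalize (-1 : K) ^ s = y at *
  linear_combination (norm := skip) (-(z * y)) • a1 + (z * x) • a2
  match_scalars <;> grind

/-- Commutativity up to homotopy: for cocycles, the brace `f{g}` is, up to sign, a homotopy between
the two orders of the cup product. This follows from the pre-Lie identity for `(μ, f, g)`,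
`(f, μ, g)` and `(f, g, μ)`. -/
theorem cup_comm_homotopy {r s : ℕ} {f g : V} (hf : f ∈ P.part r) (hg : g ∈ P.part s)
    (hdf : P.d μ r f = 0) (hdg : P.d μ s g = 0) :
    P.cup μ r s f g - (-1 : K) ^ ((r + 1) * (s + 1)) • P.cup μ s r g f =
      P.d μ (r + s) (-((-1 : K) ^ (r + s + s * (r + 1)) • P.brace1 r s f g)) := by
  have hf' : P.brace1 1 r μ f = (-1 : K) ^ r • P.brace1 r 1 f μ := by
    rw [d, sub_eq_zero] at hdf
    rw [← hdf, smul_smul, neg_one_pow_mul_self, one_smul]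
  have hg' : P.brace1 1 s μ g = (-1 : K) ^ s • P.brace1 s 1 g μ := by
    rw [d, sub_eq_zero] at hdg
    rw [← hdg, smul_smul, neg_one_pow_mul_self, one_smul]
  have a1 := P.brace1_brace1 hμ.mem hf hg
  have a2 := P.brace1_brace1 hf hμ.mem hg
  have a3 := P.brace1_brace1 hf hg hμ.mem
  -- For a cocycle `μ{f}` may be replaced by `± f{μ}`.
  rw [hf', (P.isLinearMap_brace1_left _ _ _).map_smul] at a1
  rw [hg', (P.isLinearMap_brace1_right _ hf).map_smul] at a2
  have e1 := neg_one_pow_mul_self (K := K) r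
  have e2 := neg_one_pow_mul_self (K := K) s
  have e3 := neg_one_pow_mul_self (K := K) (r * s)
  simp only [cup, d, (P.isLinearMap_brace1_right _ hμ.mem).map_smul,
    (P.isLinearMap_brace1_left _ _ _).map_smul, (P.isLinearMap_brace1_right _ hμ.mem).map_neg,
    (P.isLinearMap_brace1_left _ _ _).map_neg]
  simp only [add_comm 1 r, add_comm 1 s, mul_comm s r, pow_add, mul_add, add_mul, pow_one, mul_one,
    one_mul] at a1 a2 a3 ⊢
  generalize (-1 : K) ^ (r * s) = z at *
  generalize (-1 : K) ^ r = x at *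
  generalize (-1 : K) ^ s = y at *
  linear_combination (norm := skip) (-(z * y)) • a1 + (x * y * z) • a2 - (x * z) • a3
  match_scalars <;> grind

/-- The Leibniz rule up to homotopy: for cocycles, the brace `h{f, g}` is, up to sign, the homotopy
in question. Here `(f ∪ g){h}` is a sum of cup products, and the other half `h{f ∪ g}` of the
bracket is compared with `(h{f}) ∪ g` and `f ∪ (h{g})` by moving `μ` through `h{f, g}`. -/
theorem bracket_cup_homotopy {r s t : ℕ} {f g h : V} (hf : f ∈ P.part r) (hg : g ∈ P.part s)
    (hh : h ∈ P.part t) (hdf : P.d μ r f = 0) (hdg : P.d μ s g = 0) (hdh : P.d μ t h = 0) :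
    P.bracket (r + s + 1) t (P.cup μ r s f g) h -
      (P.cup μ (r + t) s (P.bracket r t f h) g +
        (-1 : K) ^ (t * (r + 1)) • P.cup μ r (s + t) f (P.bracket s t g h)) =
      P.d μ (t + r + s) (-((-1 : K) ^ (r * s + r * t + s * t + r + t) • P.brace2 t r s h f g)) := by
  have hf' : P.brace1 1 r μ f = (-1 : K) ^ r • P.brace1 r 1 f μ := by
    rw [d, sub_eq_zero] at hdf
    rw [← hdf, smul_smul, neg_one_pow_mul_self, one_smul]
  have hg' : P.brace1 1 s μ g = (-1 : K) ^ s • P.brace1 s 1 g μ := by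
    rw [d, sub_eq_zero] at hdg
    rw [← hdg, smul_smul, neg_one_pow_mul_self, one_smul]
  have hh' : P.brace1 1 t μ h = (-1 : K) ^ t • P.brace1 t 1 h μ := by
    rw [d, sub_eq_zero] at hdh
    rw [← hdh, smul_smul, neg_one_pow_mul_self, one_smul]
  have a1 := P.brace2_brace1 hμ.mem hf hg hh
  have a2 := P.brace1_brace2 hμ.mem hh hf hg
  have a3 := P.brace1_brace2 hh hμ.mem hf hg
  have a4 := P.brace2_brace1 hh hf hg hμ.mem
  -- The braces with three insertions in `a3` and `a4` cancel; those into `μ` vanish.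
  rw [hh', (P.isLinearMap_brace2_left _ _ _ _ _).map_smul] at a2
  rw [hf', hg', (P.isLinearMap_brace2_middle _ _ hh _).map_smul,
    (P.isLinearMap_brace2_right _ hh hf).map_smul] at a3
  have e1 := neg_one_pow_mul_self (K := K) r
  have e2 := neg_one_pow_mul_self (K := K) s
  have e3 := neg_one_pow_mul_self (K := K) t
  have e4 := neg_one_pow_mul_self (K := K) (r * s)
  have e5 := neg_one_pow_mul_self (K := K) (r * t)
  have e6 := neg_one_pow_mul_self (K := K) (s * t)
  simp only [cup, d, bracket, (P.isLinearMap_brace1_right _ hμ.mem).map_smul,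
    (P.isLinearMap_brace1_right _ hh).map_smul,
    (P.isLinearMap_brace1_left _ _ _).map_smul, (P.isLinearMap_brace1_right _ hμ.mem).map_neg,
    (P.isLinearMap_brace1_left _ _ _).map_neg,
    (P.isLinearMap_brace2_middle _ _ hμ.mem _).map_smul,
    (P.isLinearMap_brace2_middle _ _ hμ.mem _).map_sub,
    (P.isLinearMap_brace2_right _ hμ.mem hf).map_smul,
    (P.isLinearMap_brace2_right _ hμ.mem hf).map_sub]
  simp only [brace3_one, smul_zero, add_zero, add_comm 1 r, add_comm 1 s, add_comm 1 t,
    add_comm t r, add_comm t s, add_right_comm r 1 s,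
    add_right_comm r t s,
    mul_comm s r, mul_comm t r, mul_comm t s,
    pow_add, mul_add, add_mul, mul_one, one_mul] at a1 a2 a3 a4 ⊢
  generalize (-1 : K) ^ (r * s) = z at *
  generalize (-1 : K) ^ (r * t) = v at *
  generalize (-1 : K) ^ (s * t) = w at *
  generalize (-1 : K) ^ r = x at *
  generalize (-1 : K) ^ s = y at *
  generalize (-1 : K) ^ t = u at *
  linear_combination (norm := skip) (z * y) • a1 - (z * y * v * w) • a2 +
    (z * y * v * w * u) • a3 - (z * v * w * x * u) • a4
  match_scalars <;> grind

end SignedOperad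

/-! ### Multilinear maps as functions of sequences -/

section Sequences

variable {K A : Type*} [Field K] [AddCommGroup A] [Module K A]

/-- The sequence
`(α^s a₀, …, α^s a_{i-1}, g (aᵢ, aᵢ₊₁, …), α^s a_{i+s+1}, α^s a_{i+s+2}, …)`. -/
def insertSeq (α : A →ₗ[K] A) (s i : ℕ) (g : (ℕ → A) → A) (a : ℕ → A) : ℕ → A := fun j =>
  if j < i then (α ^ s) (a j) else if i < j then (α ^ s) (a (j + s)) else g fun k => a (i + k)

/-- A multilinear map in `n` variables as a function of infinite sequences, depending on the first
`n` entries only. Multilinear maps in `m + n` and in `n + m` variables then have the same type. -/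
def evalSeq (n : ℕ) : Multi K A n →ₗ[K] ((ℕ → A) → A) where
  toFun f a := f fun i => a i
  map_add' _ _ := rfl
  map_smul' _ _ := rfl

theorem evalSeq_apply {n : ℕ} (f : Multi K A n) (a : ℕ → A) : evalSeq n f a = f fun i => a i := rfl

theorem evalSeq_injective (n : ℕ) : Function.Injective (evalSeq (K := K) (A := A) n) := by
  intro f g h
  ext a
  have := congrFun h fun i => if hi : i < n then a ⟨i, hi⟩ else 0
  simpa [evalSeq_apply] using this

theorem evalSeq_domDomCongr {m n : ℕ} (h : m = n) (f : Multi K A m) :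
    evalSeq n (f.domDomCongr (finCongr h)) = evalSeq m f := by
  subst h
  rfl

theorem evalSeq_congr {n : ℕ} (f : Multi K A n) {a b : ℕ → A} (h : ∀ i < n, a i = b i) :
    evalSeq n f a = evalSeq n f b := by
  rw [evalSeq_apply, evalSeq_apply]
  exact congrArg f (funext fun i => h i i.2)

theorem evalSeq_insertAt (α : A →ₗ[K] A) {r s : ℕ} (f : Multi K A (r + 1)) (g : Multi K A (s + 1))
    (i : Fin (r + 1)) (a : ℕ → A) :
    evalSeq _ (insertAt α f g i) a = evalSeq _ f (insertSeq α s i (evalSeq _ g) a) := by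
  refine congrArg f (funext fun j => ?_)
  simp only [insertArgs, insertSeq, Fin.lt_def]
  rfl

theorem isLinearMap_insertSeq (α : A →ₗ[K] A) {n : ℕ} (f : Multi K A n) (s : ℕ) {i : ℕ}
    (hi : i < n) : IsLinearMap K fun g a => evalSeq n f (insertSeq α s i g a) := by
  have key : ∀ g a, evalSeq n f (insertSeq α s i g a) =
      f (Function.update (fun j : Fin n => insertSeq α s i 0 a j) ⟨i, hi⟩
        (g fun k => a (i + k))) := by
    intro g a
    refine congrArg f (funext fun j => ?_)
    rw [Function.update_apply]
    split_ifs with h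
    · simp [h, insertSeq]
    · have h' : j.1 ≠ i := fun e => h (Fin.ext e)
      rcases lt_or_gt_of_ne h' with h1 | h1
      · simp [insertSeq, h1]
      · simp [insertSeq, h1, h1.not_gt]
  constructor
  · intro g g'
    funext a
    simp only [key, Pi.add_apply, f.map_update_add]
  · intro c g
    funext a
    simp only [key, Pi.smul_apply, f.map_update_smul]

end Sequences

namespace HomAssociativeAlgebra

variable {K A : Type*} [Field K] [AddCommGroup A] [Module K A] (D : HomAssociativeAlgebra K A)

theorem twist_pow_apply {n : ℕ} {f : Multi K A n} (hf : f ∈ D.cochains n) (k : ℕ)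
    (a : Fin n → A) : (D.twist ^ k) (f a) = f fun i => (D.twist ^ k) (a i) := by
  induction k with
  | zero => rfl
  | succ k ih =>
    simp only [pow_succ', Module.End.mul_apply, ih]
    exact hf _

theorem twist_pow_comm (j k : ℕ) (x : A) :
    (D.twist ^ j) ((D.twist ^ k) x) = (D.twist ^ k) ((D.twist ^ j) x) := by
  rw [← Module.End.mul_apply, ← Module.End.mul_apply, ← pow_add, ← pow_add, add_comm]

theorem twist_comm_pow (k : ℕ) (x : A) :
    D.twist ((D.twist ^ k) x) = (D.twist ^ k) (D.twist x) := by
  simpa using D.twist_pow_comm 1 k x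

theorem twist_pow_evalSeq {n : ℕ} {f : Multi K A n} (hf : f ∈ D.cochains n) (k : ℕ)
    (a : ℕ → A) : (D.twist ^ k) (evalSeq n f a) = evalSeq n f fun i => (D.twist ^ k) (a i) :=
  D.twist_pow_apply hf k _

theorem insertAt_mem {m n : ℕ} {f : Multi K A m} {g : Multi K A n} (hf : f ∈ D.cochains m)
    (hg : g ∈ D.cochains n) (i : Fin m) : insertAt D.twist f g i ∈ D.cochains (m + n - 1) := by
  intro a
  refine (hf _).trans (congrArg f (funext fun j => ?_))
  simp only [insertArgs]
  split_ifs
  · exact D.twist_comm_pow _ _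
  · exact D.twist_comm_pow _ _
  · exact hg _

theorem evalSeq_mem {n r : ℕ} (h : n = r + 1) {f : Multi K A n} (hf : f ∈ D.cochains n) :
    evalSeq n f ∈ (D.cochains (r + 1)).map (evalSeq (r + 1)) := by
  subst h
  exact Submodule.mem_map_of_mem hf

/-- The cochains `C^{r+1}_α(A, A)`, as functions of sequences, with the compositions `f ∘ᵢ g = f
(α^s a₀, …, g (aᵢ, …, a_{i+s}), …, α^s a_{r+s})`. The powers of `α` make the compositions
associative since all cochains commute with `α`. -/
def signedOperad : SignedOperad K ((ℕ → A) → A) where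
  part r := (D.cochains (r + 1)).map (evalSeq (r + 1))
  comp s i f g := (-1 : K) ^ (s * i) • fun a => f (insertSeq D.twist s i g a)
  comp_left s i g :=
    { map_add := fun f f' => by
        rw [← smul_add]; rfl
      map_smul := fun c f => by
        rw [smul_comm]; rfl }
  comp_right := by
    rintro r s i _ ⟨f, -, rfl⟩ hi
    have h := isLinearMap_insertSeq D.twist f s (Nat.lt_succ_of_le hi)
    constructor
    · intro g g'
      rw [h.map_add, smul_add]
    · intro c g
      rw [h.map_smul, smul_comm]
  comp_mem := by
    rintro r s i _ _ ⟨f, hf, rfl⟩ ⟨g, hg, rfl⟩ hi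
    refine Submodule.smul_mem _ _ ?_
    have h := D.evalSeq_mem (r := r + s) (by omega) (D.insertAt_mem hf hg ⟨i, by omega⟩)
    convert h using 1
    funext a
    rw [evalSeq_insertAt]
  comp_seq := by
    rintro r s t i k _ g h ⟨f, hf, rfl⟩ hi hk
    -- The sign of the inner composition is pulled out of `f` by linearity.
    have h' := isLinearMap_insertSeq D.twist f (s + t) (Nat.lt_succ_of_le hi)
    rw [h'.map_smul, smul_smul]
    funext a
    simp only [Pi.smul_apply, smul_smul, ← pow_add]
    refine congrArg₂ _ (congrArg _ (by ring)) (congrArg _ (funext fun j => ?_))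
    rcases lt_trichotomy j i with hj | rfl | hj
    · have h1 : j < i + k := by omega
      simp [insertSeq, hj, h1, pow_add]
    · simp only [insertSeq, lt_irrefl, if_false]
      refine congrArg g (funext fun l => ?_)
      simp only [add_lt_add_iff_left, add_assoc]
      rfl
    · have h1 : i + k < j + s := by omega
      simp [insertSeq, hj, hj.not_gt, h1, h1.not_gt, pow_add, add_assoc]
  comp_par := by
    rintro s t i j f _ _ ⟨g, hg, rfl⟩ ⟨h, hh, rfl⟩ hij
    funext a
    simp only [Pi.smul_apply, smul_smul, ← pow_add]
    refine congrArg₂ _ (congrArg _ (by ring)) (congrArg _ (funext fun l => ?_))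
    rcases lt_trichotomy l i with hl | rfl | hl
    · have h1 : l < j + s := by omega
      have h2 : l < j := by omega
      simp only [insertSeq, hl, h1, h2, if_true]
      exact D.twist_pow_comm _ _ _
    · simp only [insertSeq, lt_irrefl, if_false, hij, if_true]
      rw [D.twist_pow_evalSeq hg]
      refine evalSeq_congr _ fun k hk => ?_
      rw [if_pos (by omega)]
    · rcases lt_trichotomy l j with hlj | rfl | hlj
      · have h1 : l + s < j + s := by omega
        simp only [insertSeq, hl, hl.not_gt, hlj, h1, if_true, if_false]
        exact D.twist_pow_comm _ _ _
      · simp only [insertSeq, lt_irrefl, if_false, hl, hl.not_gt, if_true]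
        rw [D.twist_pow_evalSeq hh]
        refine evalSeq_congr _ fun k hk => ?_
        rw [if_neg (by omega), if_pos (by omega), add_right_comm]
      · have h1 : j + s < l + s := by omega
        have h2 : i < l + t := by omega
        simp only [insertSeq, hl, hl.not_gt, hlj, hlj.not_gt, h1, h1.not_gt, h2, h2.not_gt, if_true,
          if_false, add_right_comm l s t]
        exact D.twist_pow_comm _ _ _

end HomAssociativeAlgebra

/-! ### The operations on cochains in terms of the operad -/

namespace HomAssociativeAlgebra

variable {K A : Type*} [Field K] [AddCommGroup A] [Module K A] (D : HomAssociativeAlgebra K A)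

theorem evalSeq_mem_part {n r : ℕ} (h : n = r + 1) {f : Multi K A n} (hf : f ∈ D.cochains n) :
    evalSeq n f ∈ D.signedOperad.part r :=
  D.evalSeq_mem h hf

theorem evalSeq_circ {r s : ℕ} (f : Multi K A (r + 1)) (g : Multi K A (s + 1)) :
    evalSeq _ (circ D.twist f g) = D.signedOperad.brace1 r s (evalSeq _ f) (evalSeq _ g) := by
  rw [circ, map_sum, SignedOperad.brace1, Finset.sum_range]
  refine Finset.sum_congr rfl fun i _ => ?_
  rw [map_smul]
  refine congrArg _ (funext fun a => evalSeq_insertAt _ _ _ _ _)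

theorem evalSeq_bracketCochain {m n r s : ℕ} (hm : m = r + 1) (hn : n = s + 1) (f : Multi K A m)
    (g : Multi K A n) :
    evalSeq _ (bracketCochain D.twist f g) =
      D.signedOperad.bracket r s (evalSeq _ f) (evalSeq _ g) := by
  subst hm hn
  rw [bracketCochain, map_sub, map_smul, evalSeq_domDomCongr, evalSeq_circ, evalSeq_circ]
  rfl

/-- The product of `A`, as an element of degree `1` of the operad. -/
def mulSeq : (ℕ → A) → A := evalSeq 2 (mulMulti D.mul)

theorem mulSeq_apply (a : ℕ → A) : D.mulSeq a = D.mul (a 0) (a 1) := rfl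

/-- Multiplicativity says that the product is a cochain, hom-associativity that it is a
multiplication on the operad. -/
theorem isMultiplication_mulSeq (hD : D.IsMultiplicative) :
    D.signedOperad.IsMultiplication D.mulSeq where
  mem := D.evalSeq_mem_part rfl fun a => hD _ _
  brace1_self := by
    funext a
    simp only [SignedOperad.brace1, Finset.sum_range_succ, Finset.sum_range_zero, signedOperad,
      Pi.add_apply, Pi.smul_apply, Pi.zero_apply, mulSeq_apply, insertSeq]
    simp [D.hom_assoc]

theorem evalSeq_differential {r : ℕ} (f : Multi K A (r + 1)) :
    evalSeq _ (D.differential (r + 1) f) = D.signedOperad.d D.mulSeq r (evalSeq _ f) := by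
  funext a
  have h1 : evalSeq _ (D.differential (r + 1) f) a =
      D.differentialFun f (fun i : Fin (r + 2) => a i) := rfl
  rw [h1, differentialFun, SignedOperad.d, SignedOperad.brace1, SignedOperad.brace1,
    Finset.sum_range_succ, Finset.sum_range_succ, Finset.sum_range_zero, zero_add]
  simp only [signedOperad, Pi.sub_apply, Pi.smul_apply, Pi.add_apply, Finset.sum_apply, mul_zero,
    pow_zero, one_smul, one_mul, mul_one, smul_add, smul_smul, SignedOperad.neg_one_pow_mul_self]
  have h2 : ∀ i : Fin (r + 1), (-1 : K) ^ ((i : ℕ) + 1) • f (fun j =>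
        if j < i then D.twist (a j.castSucc)
        else if i < j then D.twist (a j.succ)
        else D.mul (a i.castSucc) (a i.succ)) =
      -((-1 : K) ^ (i : ℕ) • evalSeq _ f (insertSeq D.twist 1 i D.mulSeq a)) := by
    intro i
    rw [pow_succ, mul_neg_one, neg_smul]
    refine congrArg _ (congrArg _ (congrArg f (funext fun j => ?_)))
    simp only [insertSeq, Fin.lt_def, pow_one]
    rfl
  rw [Finset.sum_congr rfl fun i _ => h2 i, Finset.sum_neg_distrib, Finset.sum_range, pow_add,
    pow_add]
  have h3 : D.mul ((D.twist ^ (r + 1 - 1)) (a ((0 : Fin (r + 2)) : ℕ)))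
      (f fun j => a (j.succ : Fin (r + 2))) =
      D.mulSeq (insertSeq D.twist r 1 (evalSeq _ f) a) := by
    rw [mulSeq_apply]
    simp [insertSeq, evalSeq_apply, add_comm 1]
  have h4 : D.mul (f fun j => a (j.castSucc : Fin (r + 2)))
      ((D.twist ^ (r + 1 - 1)) (a (Fin.last (r + 1)))) =
      D.mulSeq (insertSeq D.twist r 0 (evalSeq _ f) a) := by
    rw [mulSeq_apply]
    simp [insertSeq, evalSeq_apply, add_comm 1]
  rw [h3, h4]
  module

theorem evalSeq_cupCochain {m n r s : ℕ} (hm : m = r + 1) (hn : n = s + 1) (f : Multi K A m)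
    {g : Multi K A n} (hg : g ∈ D.cochains n) :
    evalSeq _ (D.cupCochain f g) =
      D.signedOperad.cup D.mulSeq r s (evalSeq _ f) (evalSeq _ g) := by
  subst hm hn
  have h : D.signedOperad.brace2 1 r s D.mulSeq (evalSeq _ f) (evalSeq _ g) =
      D.signedOperad.comp s (1 + r) (D.signedOperad.comp r 0 D.mulSeq (evalSeq _ f))
        (evalSeq _ g) := by
    simp [SignedOperad.brace2, Finset.sum_range_succ]
  rw [SignedOperad.cup, h]
  funext a
  simp only [signedOperad, Pi.smul_apply, smul_smul, mul_zero, pow_zero, mulSeq_apply,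
    add_comm 1 r, SignedOperad.neg_one_pow_mul_self, one_smul]
  refine congrArg₂ (fun x y => D.mul x y) ?_ ?_
  · refine congrArg f (funext fun i => ?_)
    have hi : 0 + i.1 < r + 1 := by omega
    simp only [insertSeq, hi, if_true]
    simp
  · simp only [insertSeq, add_comm 1 r]
    simp only [zero_lt_one, not_lt_zero, if_true, if_false, lt_irrefl]
    rw [D.twist_pow_evalSeq hg]
    rfl

theorem evalSeq_cup_assoc {r s t : ℕ} {f : Multi K A (r + 1)} (g : Multi K A (s + 1))
    {h : Multi K A (t + 1)} (hf : f ∈ D.cochains (r + 1)) (hh : h ∈ D.cochains (t + 1)) :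
    evalSeq _ (D.cupCochain (D.cupCochain f g) h) =
      evalSeq _ (D.cupCochain f (D.cupCochain g h)) := by
  funext a
  have h1 : evalSeq _ (D.cupCochain (D.cupCochain f g) h) a =
      D.mul (D.mul (f fun i => (D.twist ^ s) ((D.twist ^ t) (a i)))
        (g fun i => (D.twist ^ r) ((D.twist ^ t) (a (r + 1 + i)))))
        (h fun i => (D.twist ^ (r + 1 + s)) (a (r + 1 + (s + 1) + i))) := rfl
  have h2 : evalSeq _ (D.cupCochain f (D.cupCochain g h)) a =
      D.mul (f fun i => (D.twist ^ (s + 1 + t)) (a i))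
        (D.mul (g fun i => (D.twist ^ t) ((D.twist ^ r) (a (r + 1 + i))))
        (h fun i => (D.twist ^ s) ((D.twist ^ r) (a (r + 1 + (s + 1 + i)))))) := rfl
  -- One twist is split off from `f` and from `h`, as hom-associativity requires.
  have e1 : (f fun i => (D.twist ^ (s + 1 + t)) (a i)) =
      D.twist (f fun i => (D.twist ^ s) ((D.twist ^ t) (a i))) := by
    rw [hf]
    simp only [show s + 1 + t = 1 + s + t by ring, pow_add, pow_one, Module.End.mul_apply]
  have e2 : (h fun i => (D.twist ^ (r + 1 + s)) (a (r + 1 + (s + 1) + i))) =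
      D.twist (h fun i => (D.twist ^ s) ((D.twist ^ r) (a (r + 1 + (s + 1 + i))))) := by
    rw [hh]
    simp only [show r + 1 + s = 1 + s + r by ring, pow_add, pow_one, Module.End.mul_apply,
      add_assoc]
  rw [h1, h2, e1, e2, D.hom_assoc]
  simp only [D.twist_pow_comm t r]

theorem cupCochain_mem (hD : D.IsMultiplicative) {m n : ℕ} {f : Multi K A m} {g : Multi K A n}
    (hf : f ∈ D.cochains m) (hg : g ∈ D.cochains n) : D.cupCochain f g ∈ D.cochains (m + n) := by
  intro a
  refine (hD _ _).trans (congrArg₂ (fun x y => D.mul x y) ((hf _).trans ?_) ((hg _).trans ?_)) <;>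
  simp only [D.twist_comm_pow]

theorem signedOperad_cup_assoc (hD : D.IsMultiplicative) {r s t : ℕ} {f g h : (ℕ → A) → A}
    (hf : f ∈ D.signedOperad.part r) (hg : g ∈ D.signedOperad.part s)
    (hh : h ∈ D.signedOperad.part t) :
    D.signedOperad.cup D.mulSeq (r + s + 1) t (D.signedOperad.cup D.mulSeq r s f g) h =
      D.signedOperad.cup D.mulSeq r (s + t + 1) f (D.signedOperad.cup D.mulSeq s t g h) := by
  obtain ⟨f, hf, rfl⟩ := hf
  obtain ⟨g, hg, rfl⟩ := hg
  obtain ⟨h, hh, rfl⟩ := hh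
  have e := D.evalSeq_cup_assoc g hf hh
  rwa [D.evalSeq_cupCochain (r := r + s + 1) (by omega) rfl _ hh, D.evalSeq_cupCochain rfl rfl _ hg,
    D.evalSeq_cupCochain (s := s + t + 1) rfl (by omega) _ (D.cupCochain_mem hD hg hh),
    D.evalSeq_cupCochain rfl rfl _ hh] at e

end HomAssociativeAlgebra

/-! ### Cohomology classes -/

namespace HomAssociativeAlgebra

variable {K A : Type*} [Field K] [AddCommGroup A] [Module K A] (D : HomAssociativeAlgebra K A)

/-- `Z^{r+1}_α(A, A)`, as a space of functions of sequences. -/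
def cocycleSeq (r : ℕ) : Submodule K ((ℕ → A) → A) :=
  (D.cocycles (r + 1)).map (evalSeq (r + 1))

theorem mem_cocycleSeq_iff {r : ℕ} {v : (ℕ → A) → A} :
    v ∈ D.cocycleSeq r ↔
      v ∈ D.signedOperad.part r ∧ D.signedOperad.d D.mulSeq r v = 0 := by
  constructor
  · rintro ⟨f, hf, rfl⟩
    refine ⟨D.evalSeq_mem_part rfl hf.1, ?_⟩
    rw [← evalSeq_differential, LinearMap.mem_ker.1 hf.2, map_zero]
  · rintro ⟨⟨f, hf, rfl⟩, h⟩
    refine Submodule.mem_map_of_mem ⟨hf, LinearMap.mem_ker.2 (evalSeq_injective _ ?_)⟩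
    rw [evalSeq_differential, h, map_zero]

theorem evalSeq_mem_cocycleSeq_iff {n r : ℕ} (h : n = r + 1) {f : Multi K A n} :
    evalSeq n f ∈ D.cocycleSeq r ↔ f ∈ D.cocycles n := by
  subst h
  exact (evalSeq_injective _).mem_set_image

theorem coboundaries_le (hD : D.IsMultiplicative) (n : ℕ) :
    D.coboundaries (n + 1) ≤ D.cocycles (n + 1) := by
  have hμ := D.isMultiplication_mulSeq hD
  cases n with
  | zero => exact bot_le
  | succ n =>
    rintro _ ⟨f, hf, rfl⟩
    have hf' := D.evalSeq_mem_part rfl hf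
    rw [← D.evalSeq_mem_cocycleSeq_iff rfl, mem_cocycleSeq_iff, evalSeq_differential]
    exact ⟨SignedOperad.d_mem hμ hf', SignedOperad.d_d hμ hf'⟩

/-- Cocycles as multilinear maps and as functions of sequences. -/
noncomputable def cocycleEquiv (r : ℕ) : D.cocycles (r + 1) ≃ₗ[K] D.cocycleSeq r :=
  (D.cocycles (r + 1)).equivMapOfInjective _ (evalSeq_injective _)

/-- The class in `⊕_{n ≥ 2} H^n_α(A, A)` of a cocycle in `r + 1` variables, `r ≥ 1`. -/
noncomputable def seqClass {r : ℕ} (hr : 1 ≤ r) : D.cocycleSeq r →ₗ[K] D.TotalCohomology :=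
  DirectSum.lof K {n : ℕ // 2 ≤ n} (fun n => D.Cohomology n) ⟨r + 1, by omega⟩ ∘ₗ
    D.toCohomology (r + 1) ∘ₗ (D.cocycleEquiv r).symm.toLinearMap

theorem classOf_eq_seqClass {n r : ℕ} (hn : 2 ≤ n) (hr : 1 ≤ r) (h : n = r + 1) (f : Multi K A n)
    (hf : f ∈ D.cocycles n) :
    D.classOf hn f hf = D.seqClass hr ⟨evalSeq n f, (D.evalSeq_mem_cocycleSeq_iff h).2 hf⟩ := by
  subst h
  have : (⟨evalSeq _ f, (D.evalSeq_mem_cocycleSeq_iff rfl).2 hf⟩ : D.cocycleSeq r) =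
    D.cocycleEquiv r ⟨f, hf⟩ := rfl
  rw [this, seqClass, LinearMap.comp_apply, LinearMap.comp_apply, LinearEquiv.coe_coe,
    LinearEquiv.symm_apply_apply]
  rfl

theorem seqClass_congr {r s : ℕ} {hr : 1 ≤ r} {hs : 1 ≤ s} (h : r = s) {v : D.cocycleSeq r}
    {w : D.cocycleSeq s} (hvw : v.1 = w.1) : D.seqClass hr v = D.seqClass hs w := by
  subst h
  rw [Subtype.ext hvw]

theorem seqClass_cast {r s : ℕ} (h : r = s) (hr : 1 ≤ r) (v : D.cocycleSeq r) :
    D.seqClass hr v = D.seqClass (h ▸ hr) ⟨v.1, h ▸ v.2⟩ :=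
  D.seqClass_congr h rfl

theorem seqClass_eq_zero {r k : ℕ} (hr : 1 ≤ r) (h : r = k + 1) {w : (ℕ → A) → A}
    (hw : w ∈ D.signedOperad.part k) {v : D.cocycleSeq r}
    (hv : v.1 = D.signedOperad.d D.mulSeq k w) : D.seqClass hr v = 0 := by
  subst h
  obtain ⟨v, f, hf, rfl⟩ := v
  obtain ⟨u, hu, rfl⟩ := hw
  rw [← evalSeq_differential] at hv
  have hfu : f = D.differential (k + 1) u := evalSeq_injective _ hv
  have h1 := D.classOf_eq_seqClass (by omega) hr rfl f hf
  refine h1.symm.trans ?_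
  have h2 : D.toCohomology (k + 2) ⟨f, hf⟩ = 0 :=
    (Submodule.Quotient.mk_eq_zero _).2 ⟨u, hu, hfu.symm⟩
  rw [classOf, h2, map_zero]

theorem totalCohomology_induction {p : D.TotalCohomology → Prop} (x : D.TotalCohomology)
    (h0 : p 0) (hadd : ∀ x y, p x → p y → p (x + y))
    (h : ∀ (r : ℕ) (hr : 1 ≤ r) (v : D.cocycleSeq r), p (D.seqClass hr v)) : p x := by
  induction x using DirectSum.induction_on with
  | zero => exact h0
  | add x y hx hy => exact hadd x y hx hy
  | of n z =>
    obtain ⟨f, rfl⟩ := Submodule.mkQ_surjective _ z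
    obtain ⟨n, hn⟩ := n
    have := D.classOf_eq_seqClass hn (r := n - 1) (by omega) (by omega) f.1 f.2
    have h' := h (n - 1) (by omega) ⟨_, (D.evalSeq_mem_cocycleSeq_iff (n := n) (by omega)).2 f.2⟩
    rw [← this] at h'
    exact h'

theorem exists_seqClass_of_mem {i : ℤ} {x : D.TotalCohomology} (hx : x ∈ D.homogeneousPart i) :
    x = 0 ∨ ∃ (r : ℕ) (hr : 1 ≤ r) (v : D.cocycleSeq r), i = r + 1 ∧ x = D.seqClass hr v := by
  by_cases hi : 2 ≤ i
  · right
    obtain ⟨n, rfl⟩ := Int.eq_ofNat_of_zero_le (by omega : 0 ≤ i)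
    have hn : 2 ≤ n := by exact_mod_cast hi
    obtain ⟨f, hf⟩ := Submodule.mkQ_surjective _ (x ⟨n, hn⟩)
    refine ⟨n - 1, by omega, ⟨_, (D.evalSeq_mem_cocycleSeq_iff (n := n) (by omega)).2 f.2⟩,
      by omega, ?_⟩
    rw [← D.classOf_eq_seqClass hn (r := n - 1) (by omega) (by omega) f.1 f.2]
    refine DFinsupp.ext fun k => ?_
    by_cases hk : k = ⟨n, hn⟩
    · subst hk
      rw [classOf, DirectSum.lof_eq_of, DirectSum.of_eq_same]
      exact hf.symm
    · rw [hx k (fun e => hk (Subtype.ext (by exact_mod_cast e))), classOf, DirectSum.lof_eq_of,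
        DirectSum.of_eq_of_ne _ _ _ hk]
  · left
    refine DFinsupp.ext fun k => ?_
    have := k.2
    exact hx k (by omega)

theorem seqClass_mem {r : ℕ} (hr : 1 ≤ r) (v : D.cocycleSeq r) {i : ℤ} (hi : i = r + 1) :
    D.seqClass hr v ∈ D.homogeneousPart i := by
  intro n hn
  refine DirectSum.of_eq_of_ne _ _ _ fun e => hn ?_
  subst e
  simp [hi]

theorem isInternal_homogeneousPart : DirectSum.IsInternal D.homogeneousPart := by
  have key : ∀ (x : ⨁ i, D.homogeneousPart i) (n : {n : ℕ // 2 ≤ n}),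
      (DirectSum.coeAddMonoidHom D.homogeneousPart x) n =
        (x ((n : ℕ) : ℤ) : D.TotalCohomology) n := by
    intro x n
    induction x using DirectSum.induction_on with
    | zero => simp
    | add x y hx hy => simp [hx, hy]
    | of i y =>
      rw [DirectSum.coeAddMonoidHom_of]
      by_cases hi : ((n : ℕ) : ℤ) = i
      · subst hi
        rw [DirectSum.of_eq_same]
      · rw [DirectSum.of_eq_of_ne _ _ _ hi, y.2 n hi]
        rfl
  constructor
  · rw [injective_iff_map_eq_zero]
    intro x hx
    refine DFinsupp.ext fun i => Subtype.ext (DFinsupp.ext fun n => ?_)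
    by_cases hi : ((n : ℕ) : ℤ) = i
    · subst hi
      exact (key x n).symm.trans (by rw [hx]; rfl)
    · exact (x i).2 n hi
  · intro y
    induction y using D.totalCohomology_induction with
    | h0 => exact ⟨0, map_zero _⟩
    | hadd x y hx hy =>
      obtain ⟨x, rfl⟩ := hx
      obtain ⟨y, rfl⟩ := hy
      exact ⟨x + y, map_add _ _ _⟩
    | h r hr v =>
      exact ⟨DirectSum.of (fun i => D.homogeneousPart i) (r + 1) ⟨_, D.seqClass_mem hr v rfl⟩,
        DirectSum.coeAddMonoidHom_of _ _ _⟩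

/-- A family of bilinear maps on cocycles that vanish when one argument is a coboundary induces a
bilinear map on the total cohomology. -/
theorem exists_bilinear {T : Type*} [AddCommGroup T] [Module K T]
    (β : ∀ r s : ℕ, 1 ≤ r → 1 ≤ s → D.cocycleSeq r →ₗ[K] D.cocycleSeq s →ₗ[K] T)
    (hl : ∀ r s hr hs (v : D.cocycleSeq r) (w : D.cocycleSeq s) k u, r = k + 1 →
      u ∈ D.signedOperad.part k → v.1 = D.signedOperad.d D.mulSeq k u → β r s hr hs v w = 0)
    (hr : ∀ r s hr hs (v : D.cocycleSeq r) (w : D.cocycleSeq s) k u, s = k + 1 →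
      u ∈ D.signedOperad.part k → w.1 = D.signedOperad.d D.mulSeq k u → β r s hr hs v w = 0) :
    ∃ B : D.TotalCohomology →ₗ[K] D.TotalCohomology →ₗ[K] T,
      ∀ (r s : ℕ) (hr : 1 ≤ r) (hs : 1 ≤ s) (v : D.cocycleSeq r) (w : D.cocycleSeq s),
        B (D.seqClass hr v) (D.seqClass hs w) = β r s hr hs v w := by
  let e : ∀ n : {n : ℕ // 2 ≤ n}, D.cocycles n →ₗ[K] D.cocycleSeq (n - 1) := fun n =>
    ((evalSeq n).domRestrict (D.cocycles n)).codRestrict _ fun f =>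
      (D.evalSeq_mem_cocycleSeq_iff (by have := n.2; omega)).2 f.2
  have he : ∀ (n : {n : ℕ // 2 ≤ n}) (f : D.cocycles n),
      f ∈ (D.coboundaries n).submoduleOf (D.cocycles n) →
      ∃ k u, (n : ℕ) - 1 = k + 1 ∧ u ∈ D.signedOperad.part k ∧
        (e n f).1 = D.signedOperad.d D.mulSeq k u := by
    rintro ⟨n, hn⟩ f hf
    obtain ⟨k, rfl⟩ := Nat.exists_eq_add_of_le' hn
    obtain ⟨u, hu, hfu⟩ := hf
    refine ⟨k, evalSeq _ u, rfl, D.evalSeq_mem_part rfl hu, ?_⟩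
    rw [← evalSeq_differential]
    exact congrArg (evalSeq (k + 2)) hfu.symm
  let γ : ∀ m n : {n : ℕ // 2 ≤ n}, D.cocycles m →ₗ[K] D.cocycles n →ₗ[K] T := fun m n =>
    (β (m - 1) (n - 1) (by have := m.2; omega) (by have := n.2; omega)).compl₁₂ (e m) (e n)
  let γ' : ∀ m n : {n : ℕ // 2 ≤ n}, D.cocycles m →ₗ[K] D.Cohomology n →ₗ[K] T := fun m n =>
    (Submodule.liftQ _ (γ m n).flip (by
      intro f hf
      obtain ⟨k, u, h1, h2, h3⟩ := he n f hf
      refine LinearMap.ext fun v => hr _ _ _ _ _ _ k u h1 h2 h3)).flip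
  let γ'' : ∀ m n : {n : ℕ // 2 ≤ n}, D.Cohomology m →ₗ[K] D.Cohomology n →ₗ[K] T := fun m n =>
    Submodule.liftQ _ (γ' m n) (by
      intro f hf
      obtain ⟨k, u, h1, h2, h3⟩ := he m f hf
      refine LinearMap.ext fun v => ?_
      obtain ⟨v, rfl⟩ := Submodule.mkQ_surjective _ v
      exact hl _ _ _ _ _ _ k u h1 h2 h3)
  let B : D.TotalCohomology →ₗ[K] D.TotalCohomology →ₗ[K] T :=
    DirectSum.toModule K _ _ fun m => LinearMap.flip (DirectSum.toModule K _ _ fun n =>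
      (γ'' m n).flip)
  refine ⟨B, fun r s hr hs v w => ?_⟩
  obtain ⟨v, f, hf, rfl⟩ := v
  obtain ⟨w, g, hg, rfl⟩ := w
  have h1 := D.classOf_eq_seqClass (by omega) hr rfl f hf
  have h2 := D.classOf_eq_seqClass (by omega) hs rfl g hg
  rw [← h1, ← h2, classOf, classOf]
  simp only [B, DirectSum.toModule_lof, LinearMap.flip_apply]
  rfl

end HomAssociativeAlgebra

/-! ### The Gerstenhaber algebra structure on cohomology -/

namespace HomAssociativeAlgebra

variable {K A : Type*} [Field K] [AddCommGroup A] [Module K A] (D : HomAssociativeAlgebra K A)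

theorem cup_mem_cocycleSeq (hD : D.IsMultiplicative) {r s : ℕ} {v w : (ℕ → A) → A}
    (hv : v ∈ D.cocycleSeq r) (hw : w ∈ D.cocycleSeq s) :
    D.signedOperad.cup D.mulSeq r s v w ∈ D.cocycleSeq (r + s + 1) := by
  have hμ := D.isMultiplication_mulSeq hD
  rw [mem_cocycleSeq_iff] at *
  refine ⟨SignedOperad.cup_mem hμ hv.1 hw.1, ?_⟩
  rw [SignedOperad.d_cup hμ hv.1 hw.1, hv.2, hw.2, (SignedOperad.isLinearMap_cup_left hμ).map_zero,
    (SignedOperad.isLinearMap_cup_right hμ hv.1).map_zero, smul_zero, zero_add]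

theorem bracket_mem_cocycleSeq (hD : D.IsMultiplicative) {r s : ℕ} {v w : (ℕ → A) → A}
    (hv : v ∈ D.cocycleSeq r) (hw : w ∈ D.cocycleSeq s) :
    D.signedOperad.bracket r s v w ∈ D.cocycleSeq (r + s) := by
  have hμ := D.isMultiplication_mulSeq hD
  rw [mem_cocycleSeq_iff] at *
  refine ⟨D.signedOperad.bracket_mem hv.1 hw.1, ?_⟩
  rw [SignedOperad.d_bracket hμ hv.1 hw.1, hv.2, hw.2,
    (SignedOperad.isLinearMap_bracket_left hw.1).map_zero,
    (SignedOperad.isLinearMap_bracket_right hv.1).map_zero, smul_zero, zero_add]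

theorem exists_cup (hD : D.IsMultiplicative) :
    ∃ B : D.TotalCohomology →ₗ[K] D.TotalCohomology →ₗ[K] D.TotalCohomology,
      ∀ (r s : ℕ) (hr : 1 ≤ r) (hs : 1 ≤ s) (v : D.cocycleSeq r) (w : D.cocycleSeq s),
        B (D.seqClass hr v) (D.seqClass hs w) = D.seqClass (r := r + s + 1) (by omega)
          ⟨D.signedOperad.cup D.mulSeq r s v w, D.cup_mem_cocycleSeq hD v.2 w.2⟩ := by
  have hμ := D.isMultiplication_mulSeq hD
  have hZ := fun {r : ℕ} (v : D.cocycleSeq r) => D.mem_cocycleSeq_iff.1 v.2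
  refine D.exists_bilinear (fun r s hr hs => LinearMap.mk₂ K (fun v w =>
    D.seqClass (r := r + s + 1) (by omega)
      ⟨D.signedOperad.cup D.mulSeq r s v w, D.cup_mem_cocycleSeq hD v.2 w.2⟩) ?_ ?_ ?_ ?_) ?_ ?_
  · intro v v' w
    rw [← map_add]
    exact congrArg _ (Subtype.ext ((SignedOperad.isLinearMap_cup_left hμ).map_add v.1 v'.1))
  · intro c v w
    rw [← map_smul]
    exact congrArg _ (Subtype.ext ((SignedOperad.isLinearMap_cup_left hμ).map_smul c v.1))
  · intro v w w'
    rw [← map_add]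
    exact congrArg _ (Subtype.ext
      ((SignedOperad.isLinearMap_cup_right hμ (hZ v).1).map_add w.1 w'.1))
  · intro c v w
    rw [← map_smul]
    exact congrArg _ (Subtype.ext ((SignedOperad.isLinearMap_cup_right hμ (hZ v).1).map_smul c w.1))
  · rintro r s hr hs v w k u rfl hu hv
    refine D.seqClass_eq_zero (by omega) (k := k + s + 1) (by omega)
      (SignedOperad.cup_mem hμ hu (hZ w).1) ?_
    rw [SignedOperad.d_cup hμ hu (hZ w).1, (hZ w).2,
      (SignedOperad.isLinearMap_cup_right hμ hu).map_zero, smul_zero, add_zero, ← hv]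
  · rintro r s hr hs v w k u rfl hu hw
    refine D.seqClass_eq_zero (by omega) (k := r + k + 1) (by omega) (w := (-1 : K) ^ (r + 1) •
      D.signedOperad.cup D.mulSeq r k v u)
      (Submodule.smul_mem _ _ (SignedOperad.cup_mem hμ (hZ v).1 hu)) ?_
    rw [(SignedOperad.isLinearMap_d hμ _).map_smul, SignedOperad.d_cup hμ (hZ v).1 hu, (hZ v).2,
      (SignedOperad.isLinearMap_cup_left hμ).map_zero, zero_add, smul_smul,
      SignedOperad.neg_one_pow_mul_self, one_smul, ← hw]

theorem exists_bracket (hD : D.IsMultiplicative) :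
    ∃ B : D.TotalCohomology →ₗ[K] D.TotalCohomology →ₗ[K] D.TotalCohomology,
      ∀ (r s : ℕ) (hr : 1 ≤ r) (hs : 1 ≤ s) (v : D.cocycleSeq r) (w : D.cocycleSeq s),
        B (D.seqClass hr v) (D.seqClass hs w) = D.seqClass (r := r + s) (by omega)
          ⟨D.signedOperad.bracket r s v w, D.bracket_mem_cocycleSeq hD v.2 w.2⟩ := by
  have hμ := D.isMultiplication_mulSeq hD
  have hZ := fun {r : ℕ} (v : D.cocycleSeq r) => D.mem_cocycleSeq_iff.1 v.2
  refine D.exists_bilinear (fun r s hr hs => LinearMap.mk₂ K (fun v w =>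
    D.seqClass (r := r + s) (by omega)
      ⟨D.signedOperad.bracket r s v w, D.bracket_mem_cocycleSeq hD v.2 w.2⟩) ?_ ?_ ?_ ?_) ?_ ?_
  · intro v v' w
    rw [← map_add]
    exact congrArg _ (Subtype.ext
      ((SignedOperad.isLinearMap_bracket_left (hZ w).1).map_add v.1 v'.1))
  · intro c v w
    rw [← map_smul]
    exact congrArg _ (Subtype.ext
      ((SignedOperad.isLinearMap_bracket_left (hZ w).1).map_smul c v.1))
  · intro v w w'
    rw [← map_add]
    exact congrArg _ (Subtype.ext
      ((SignedOperad.isLinearMap_bracket_right (hZ v).1).map_add w.1 w'.1))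
  · intro c v w
    rw [← map_smul]
    exact congrArg _ (Subtype.ext
      ((SignedOperad.isLinearMap_bracket_right (hZ v).1).map_smul c w.1))
  · rintro r s hr hs v w k u rfl hu hv
    refine D.seqClass_eq_zero (by omega) (k := k + s) (by omega) (w := (-1 : K) ^ s •
      D.signedOperad.bracket k s u w)
      (Submodule.smul_mem _ _ (D.signedOperad.bracket_mem hu (hZ w).1)) ?_
    rw [(SignedOperad.isLinearMap_d hμ _).map_smul, SignedOperad.d_bracket hμ hu (hZ w).1, (hZ w).2,
      (SignedOperad.isLinearMap_bracket_right hu).map_zero, zero_add, smul_smul,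
      SignedOperad.neg_one_pow_mul_self, one_smul, ← hv]
  · rintro r s hr hs v w k u rfl hu hw
    refine D.seqClass_eq_zero (by omega) (k := r + k) (by omega)
      (D.signedOperad.bracket_mem (hZ v).1 hu) ?_
    rw [SignedOperad.d_bracket hμ (hZ v).1 hu, (hZ v).2,
      (SignedOperad.isLinearMap_bracket_left hu).map_zero, smul_zero, add_zero, ← hw]

theorem neg_one_zpow_cast {i : ℤ} {n : ℕ} (h : i = n) : (-1 : K) ^ i = (-1 : K) ^ n := by
  rw [h, zpow_natCast]

/-- Associativity, antisymmetry and the Jacobi identity hold for cocycles; commutativity and the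
Leibniz rule hold up to the coboundaries `cup_comm_homotopy` and `bracket_cup_homotopy`. -/
theorem isGerstenhaberAlgebra (hD : D.IsMultiplicative)
    {cup bracket : D.TotalCohomology →ₗ[K] D.TotalCohomology →ₗ[K] D.TotalCohomology}
    (hcup : ∀ (r s : ℕ) (hr : 1 ≤ r) (hs : 1 ≤ s) (v : D.cocycleSeq r) (w : D.cocycleSeq s),
      cup (D.seqClass hr v) (D.seqClass hs w) = D.seqClass (r := r + s + 1) (by omega)
        ⟨D.signedOperad.cup D.mulSeq r s v w, D.cup_mem_cocycleSeq hD v.2 w.2⟩)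
    (hbr : ∀ (r s : ℕ) (hr : 1 ≤ r) (hs : 1 ≤ s) (v : D.cocycleSeq r) (w : D.cocycleSeq s),
      bracket (D.seqClass hr v) (D.seqClass hs w) = D.seqClass (r := r + s) (by omega)
        ⟨D.signedOperad.bracket r s v w, D.bracket_mem_cocycleSeq hD v.2 w.2⟩) :
    IsGerstenhaberAlgebra K D.homogeneousPart cup bracket := by
  have hμ := D.isMultiplication_mulSeq hD
  have hZ := fun {r : ℕ} (v : D.cocycleSeq r) => D.mem_cocycleSeq_iff.1 v.2
  refine ⟨D.isInternal_homogeneousPart, ?_, ?_, ?_, ?_, ?_, ?_, ?_⟩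
  · intro i j a ha b hb
    obtain rfl | ⟨r, hr, v, rfl, rfl⟩ := D.exists_seqClass_of_mem ha
    · simp
    obtain rfl | ⟨s, hs, w, rfl, rfl⟩ := D.exists_seqClass_of_mem hb
    · simp
    rw [hcup]
    exact D.seqClass_mem _ _ (by push_cast; ring)
  · intro a b c
    induction a using D.totalCohomology_induction with
    | h0 => simp
    | hadd x y hx hy => simp only [map_add, LinearMap.add_apply, hx, hy]
    | h r hr f =>
    induction b using D.totalCohomology_induction with
    | h0 => simp
    | hadd x y hx hy => simp only [map_add, LinearMap.add_apply, hx, hy]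
    | h s hs g =>
    induction c using D.totalCohomology_induction with
    | h0 => simp
    | hadd x y hx hy => simp only [map_add, hx, hy]
    | h t ht h =>
    simp only [hcup]
    exact D.seqClass_congr (by ring) (D.signedOperad_cup_assoc hD (hZ f).1 (hZ g).1 (hZ h).1)
  · intro i j a ha b hb
    obtain rfl | ⟨r, hr, f, rfl, rfl⟩ := D.exists_seqClass_of_mem ha
    · simp
    obtain rfl | ⟨s, hs, g, rfl, rfl⟩ := D.exists_seqClass_of_mem hb
    · simp
    rw [hcup, hcup, neg_one_zpow_cast (n := (r + 1) * (s + 1)) (by push_cast; ring),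
      D.seqClass_cast (show s + r + 1 = r + s + 1 by ring),
      ← map_smul, ← sub_eq_zero, ← map_sub]
    exact D.seqClass_eq_zero _ rfl
      (Submodule.neg_mem _ (Submodule.smul_mem _ _ (D.signedOperad.brace1_mem (hZ f).1 (hZ g).1)))
      (SignedOperad.cup_comm_homotopy hμ (hZ f).1 (hZ g).1 (hZ f).2 (hZ g).2)
  · intro i j a ha b hb
    obtain rfl | ⟨r, hr, v, rfl, rfl⟩ := D.exists_seqClass_of_mem ha
    · simp
    obtain rfl | ⟨s, hs, w, rfl, rfl⟩ := D.exists_seqClass_of_mem hb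
    · simp
    rw [hbr]
    exact D.seqClass_mem _ _ (by push_cast; ring)
  · intro i j a ha b hb
    obtain rfl | ⟨r, hr, f, rfl, rfl⟩ := D.exists_seqClass_of_mem ha
    · simp
    obtain rfl | ⟨s, hs, g, rfl, rfl⟩ := D.exists_seqClass_of_mem hb
    · simp
    rw [hbr, hbr, neg_one_zpow_cast (n := r * s) (by push_cast; ring),
      D.seqClass_cast (add_comm s r),
      ← map_smul, ← map_neg]
    exact D.seqClass_congr rfl (D.signedOperad.bracket_antisymm r s f.1 g.1)
  · intro i j a ha b hb c
    obtain rfl | ⟨r, hr, f, rfl, rfl⟩ := D.exists_seqClass_of_mem ha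
    · simp
    obtain rfl | ⟨s, hs, g, rfl, rfl⟩ := D.exists_seqClass_of_mem hb
    · simp
    induction c using D.totalCohomology_induction with
    | h0 => simp
    | hadd x y hx hy =>
      simp only [map_add, hx, hy, smul_add]
      abel
    | h t ht h =>
    rw [neg_one_zpow_cast (n := r * s) (by push_cast; ring)]
    simp only [hbr]
    rw [D.seqClass_cast (show s + (r + t) = r + s + t by ring), ← map_smul, ← map_add]
    exact D.seqClass_congr (by ring) (D.signedOperad.bracket_bracket (hZ f).1 (hZ g).1 (hZ h).1)
  · intro i k a ha b c hc
    obtain rfl | ⟨r, hr, f, rfl, rfl⟩ := D.exists_seqClass_of_mem ha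
    · simp
    obtain rfl | ⟨t, ht, h, rfl, rfl⟩ := D.exists_seqClass_of_mem hc
    · simp
    induction b using D.totalCohomology_induction with
    | h0 => simp
    | hadd x y hx hy =>
      simp only [map_add, LinearMap.add_apply, hx, hy, smul_add]
      abel
    | h s hs g =>
    rw [neg_one_zpow_cast (n := t * (r + 1)) (by push_cast; ring)]
    simp only [hcup, hbr]
    rw [D.seqClass_cast (show r + t + s + 1 = r + s + 1 + t by ring),
      D.seqClass_cast (show r + (s + t) + 1 = r + s + 1 + t by ring),
      ← map_smul, ← map_add, ← sub_eq_zero, ← map_sub]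
    exact D.seqClass_eq_zero _ (k := t + r + s) (by ring)
      (Submodule.neg_mem _ (Submodule.smul_mem _ _
        (D.signedOperad.brace2_mem (hZ h).1 (hZ f).1 (hZ g).1)))
      (SignedOperad.bracket_cup_homotopy hμ (hZ f).1 (hZ g).1 (hZ h).1 (hZ f).2 (hZ g).2 (hZ h).2)

/-! ### The case of trivial twist -/

theorem twist_pow_eq_self (hα : D.twist = LinearMap.id) (k : ℕ) (x : A) :
    (D.twist ^ k) x = x := by
  rw [hα, ← Module.End.one_eq_id, one_pow, Module.End.one_apply]

theorem differential_eq_classical (hα : D.twist = LinearMap.id) {n : ℕ} (f : Multi K A n) :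
    ⇑(D.differential n f) = ClassicalHochschild.differential D.mul f := by
  funext a
  change D.differentialFun f a = _
  simp only [differentialFun, ClassicalHochschild.differential, D.twist_pow_eq_self hα]
  refine congrArg₂ _ (congrArg₂ _ rfl (Finset.sum_congr rfl fun i _ => congrArg _
    (congrArg f (funext fun j => ?_)))) rfl
  simp only [Fin.contractNth, hα, LinearMap.id_apply, Fin.lt_def, Fin.val_castSucc]
  rcases lt_trichotomy j.1 i.1 with h | h | h
  · simp [h]
  · obtain rfl := Fin.ext h
    simp
  · simp [h, h.not_gt, h.ne']

theorem cupCochain_eq_classical (hα : D.twist = LinearMap.id) {m n : ℕ} (f : Multi K A m)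
    (g : Multi K A n) : ⇑(D.cupCochain f g) = ClassicalHochschild.cup D.mul f g := by
  funext a
  change D.mul (f fun i => (D.twist ^ (n - 1)) (a (Fin.castAdd n i)))
    (g fun i => (D.twist ^ (m - 1)) (a (Fin.natAdd m i))) = _
  simp only [D.twist_pow_eq_self hα]
  rfl

theorem circ_eq_classical (hα : D.twist = LinearMap.id) {m n : ℕ} (f : Multi K A m)
    (g : Multi K A n) : ⇑(circ D.twist f g) = ClassicalHochschild.circ K f g := by
  funext a
  simp only [circ, ClassicalHochschild.circ, sum_apply, smul_apply]
  refine Finset.sum_congr rfl fun i _ => congrArg _ (congrArg f (funext fun j => ?_))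
  simp only [insertArgs, D.twist_pow_eq_self hα]

theorem bracketCochain_eq_classical (hα : D.twist = LinearMap.id) {m n : ℕ} (f : Multi K A m)
    (g : Multi K A n) :
    ⇑(bracketCochain D.twist f g) = ClassicalHochschild.bracket K f g := by
  funext a
  simp only [bracketCochain, ClassicalHochschild.bracket, sub_apply,
    smul_apply, MultilinearMap.domDomCongr_apply, D.circ_eq_classical hα]
  rfl

end HomAssociativeAlgebra

theorem mainTheorem1 {K A : Type*} [Field K] [CharZero K] [AddCommGroup A] [Module K A]
    (D : HomAssociativeAlgebra K A) (hD : D.IsMultiplicative) :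
    (∀ n, 1 ≤ n → D.coboundaries (n + 1) ≤ D.cocycles (n + 1)) ∧
    (∃ cup bracket : D.TotalCohomology →ₗ[K] D.TotalCohomology →ₗ[K] D.TotalCohomology,
      (∀ (m n : ℕ) (hm : 2 ≤ m) (hn : 2 ≤ n) (f : Multi K A m) (g : Multi K A n)
        (hf : f ∈ D.cocycles m) (hg : g ∈ D.cocycles n),
        ∃ h : D.cupCochain f g ∈ D.cocycles (m + n),
          cup (D.classOf hm f hf) (D.classOf hn g hg) =
            D.classOf (by omega) (D.cupCochain f g) h) ∧
      (∀ (m n : ℕ) (hm : 2 ≤ m) (hn : 2 ≤ n) (f : Multi K A m) (g : Multi K A n)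
        (hf : f ∈ D.cocycles m) (hg : g ∈ D.cocycles n),
        ∃ h : bracketCochain D.twist f g ∈ D.cocycles (m + n - 1),
          bracket (D.classOf hm f hf) (D.classOf hn g hg) =
            D.classOf (by omega) (bracketCochain D.twist f g) h) ∧
      IsGerstenhaberAlgebra K D.homogeneousPart cup bracket) ∧
    (D.twist = LinearMap.id →
      (∀ n, D.cochains n = ⊤) ∧
      (∀ n (f : Multi K A n), ⇑(D.differential n f) = ClassicalHochschild.differential D.mul f) ∧
      (∀ m n (f : Multi K A m) (g : Multi K A n),
        ⇑(D.cupCochain f g) = ClassicalHochschild.cup D.mul f g) ∧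
      (∀ m n (f : Multi K A m) (g : Multi K A n),
        ⇑(bracketCochain D.twist f g) = ClassicalHochschild.bracket K f g)) := by

  refine ⟨fun n _ => D.coboundaries_le hD n, ?_, fun hα => ⟨fun n => ?_,
    fun n f => D.differential_eq_classical hα f, fun m n f g => D.cupCochain_eq_classical hα f g,
    fun m n f g => D.bracketCochain_eq_classical hα f g⟩⟩
  · obtain ⟨cup, hcup⟩ := D.exists_cup hD
    obtain ⟨bracket, hbr⟩ := D.exists_bracket hD
    refine ⟨cup, bracket, ?_, ?_, D.isGerstenhaberAlgebra hD hcup hbr⟩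
    · intro m n hm hn f g hf hg
      have hv := (D.evalSeq_mem_cocycleSeq_iff (r := m - 1) (by omega)).2 hf
      have hw := (D.evalSeq_mem_cocycleSeq_iff (r := n - 1) (by omega)).2 hg
      have e := D.evalSeq_cupCochain (r := m - 1) (s := n - 1) (by omega) (by omega) f hg.1
      have h : D.cupCochain f g ∈ D.cocycles (m + n) := by
        rw [← D.evalSeq_mem_cocycleSeq_iff (r := m - 1 + (n - 1) + 1) (by omega), e]
        exact D.cup_mem_cocycleSeq hD hv hw
      refine ⟨h, ?_⟩
      rw [D.classOf_eq_seqClass hm (r := m - 1) (by omega) (by omega),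
        D.classOf_eq_seqClass hn (r := n - 1) (by omega) (by omega),
        D.classOf_eq_seqClass (r := m - 1 + (n - 1) + 1) _ (by omega) (by omega), hcup]
      exact D.seqClass_congr rfl e.symm
    · intro m n hm hn f g hf hg
      have hv := (D.evalSeq_mem_cocycleSeq_iff (r := m - 1) (by omega)).2 hf
      have hw := (D.evalSeq_mem_cocycleSeq_iff (r := n - 1) (by omega)).2 hg
      have e := D.evalSeq_bracketCochain (r := m - 1) (s := n - 1) (by omega) (by omega) f g
      have h : bracketCochain D.twist f g ∈ D.cocycles (m + n - 1) := by
        rw [← D.evalSeq_mem_cocycleSeq_iff (r := m - 1 + (n - 1)) (by omega), e]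
        exact D.bracket_mem_cocycleSeq hD hv hw
      refine ⟨h, ?_⟩
      rw [D.classOf_eq_seqClass hm (r := m - 1) (by omega) (by omega),
        D.classOf_eq_seqClass hn (r := n - 1) (by omega) (by omega),
        D.classOf_eq_seqClass (r := m - 1 + (n - 1)) _ (by omega) (by omega), hbr]
      exact D.seqClass_congr rfl e.symm
  · rw [eq_top_iff]
    intro f _ a
    simp [hα]
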